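/- Let $(W_e)_{e\in\omega}$ be the standard enumeration of the computably enumerable (c.e.) sets, and for $D\subseteq\omega$ let $W_e^D$ be the domain of the partial function computed by the $e$-th oracle program with oracle $D$. The maximum of the empty set is $-\infty$, and every infinite subset of $\omega$ has maximum $+\infty$. Define equivalence relations on $\omega$ by $$i\,E^{ce}_{max}\,j\iff\max W_i=\max W_j,\qquad i\,E^{D}_{max}\,j\iff\max W_i^D=\max W_j^D,\qquad i\,E^{D}_{card}\,j\iff|W_i^D|=|W_j^D|.$$ For equivalence relations $E,F$ on $\omega$, write $E\leq_c^n F$ ($E$ is $n$-arily reducible to $F$) if there is a total computable function $f:\omega^n\to\omega^n$ such that, whenever $f(x_0,\dots,x_{n-1})=(y_0,\dots,y_{n-1})$ and $i<j<n$, we have $x_i\,E\,x_j\iff y_i\,F\,y_j$. Say that $E$ is complete under $\leq_c^n$ among the equivalence relations of a class $\Gamma$ if $E$ is an equivalence relation in $\Gamma$ and $R\leq_c^n E$ for every equivalence relation $R$ on $\omega$ in $\Gamma$. Then: 1. $E^{ce}_{max}$ is complete under ternary reducibility $\leq_c^3$ among $\Pi^0_2$ equivalence relations, but it is not complete under $4$-ary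 reducibility $\leq_c^4$ among them. 2. For every set $D\subseteq\omega$, $E^{D}_{max}$ is complete under (computable) ternary reducibility $\leq_c^3$ among $\Pi^D_2$ equivalence relations, but it is not complete under (computable) $4$-ary reducibility $\leq_c^4$ among them. 3. $E^{\emptyset'}_{card}$ is complete under (computable) ternary reducibility $\leq_c^3$ among $\Pi^0_3$ equivalence relations, but it is not complete under (computable) $4$-ary reducibility $\leq_c^4$ among them. -/

import Mathlib

namespace FinRed

/-! ### Oracle programs -/

/-- Programs with access to an oracle: the programs of `Nat.Partrec.Code` together with one further
instruction that queries the oracle. See `OCode.eval` for the semantics. -/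
inductive OCode : Type
  | zero : OCode
  | succ : OCode
  | left : OCode
  | right : OCode
  | oracle : OCode
  | pair : OCode → OCode → OCode
  | comp : OCode → OCode → OCode
  | prec : OCode → OCode → OCode
  | rfind' : OCode → OCode

namespace OCode

/-- The code number of an oracle program. -/
def encodeCode : OCode → ℕ
  | zero => 0
  | succ => 1
  | left => 2
  | right => 3
  | oracle => 4
  | pair cf cg => 2 * (2 * Nat.pair (encodeCode cf) (encodeCode cg)) + 5
  | comp cf cg => 2 * (2 * Nat.pair (encodeCode cf) (encodeCode cg) + 1) + 5
  | prec cf cg => (2 * (2 * Nat.pair (encodeCode cf) (encodeCode cg)) + 1) + 5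
  | rfind' cf => (2 * (2 * encodeCode cf + 1) + 1) + 5

/-- The oracle program with a given code number. -/
def ofNatCode : ℕ → OCode
  | 0 => zero
  | 1 => succ
  | 2 => left
  | 3 => right
  | 4 => oracle
  | n + 5 =>
    let m := n.div2.div2
    have hm : m < n + 5 := by
      simp only [m, Nat.div2_val]
      exact
        lt_of_le_of_lt (le_trans (Nat.div_le_self _ _) (Nat.div_le_self _ _))
          (Nat.succ_le_succ (Nat.le_add_right _ _))
    have _m1 : m.unpair.1 < n + 5 := lt_of_le_of_lt m.unpair_left_le hm
    have _m2 : m.unpair.2 < n + 5 := lt_of_le_of_lt m.unpair_right_le hm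
    match n.bodd, n.div2.bodd with
    | false, false => pair (ofNatCode m.unpair.1) (ofNatCode m.unpair.2)
    | false, true => comp (ofNatCode m.unpair.1) (ofNatCode m.unpair.2)
    | true, false => prec (ofNatCode m.unpair.1) (ofNatCode m.unpair.2)
    | true, true => rfind' (ofNatCode m)
termination_by n => n
decreasing_by all_goals first | exact _m1 | exact _m2 | exact hm

theorem encode_ofNatCode : ∀ n, encodeCode (ofNatCode n) = n
  | 0 => by simp [ofNatCode, encodeCode]
  | 1 => by simp [ofNatCode, encodeCode]
  | 2 => by simp [ofNatCode, encodeCode]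
  | 3 => by simp [ofNatCode, encodeCode]
  | 4 => by simp [ofNatCode, encodeCode]
  | n + 5 => by
    let m := n.div2.div2
    have hm : m < n + 5 := by
      simp only [m, Nat.div2_val]
      exact
        lt_of_le_of_lt (le_trans (Nat.div_le_self _ _) (Nat.div_le_self _ _))
          (Nat.succ_le_succ (Nat.le_add_right _ _))
    have _m1 : m.unpair.1 < n + 5 := lt_of_le_of_lt m.unpair_left_le hm
    have _m2 : m.unpair.2 < n + 5 := lt_of_le_of_lt m.unpair_right_le hm
    have IH := encode_ofNatCode m
    have IH1 := encode_ofNatCode m.unpair.1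
    have IH2 := encode_ofNatCode m.unpair.2
    conv_rhs => rw [← Nat.bit_bodd_div2 n, ← Nat.bit_bodd_div2 n.div2]
    simp only [ofNatCode.eq_6]
    cases n.bodd <;> cases n.div2.bodd <;>
      simp [m, encodeCode, IH, IH1, IH2, Nat.bit_val]
termination_by n => n
decreasing_by all_goals first | exact _m1 | exact _m2 | exact hm

theorem ofNat_encodeCode (c : OCode) : ofNatCode (encodeCode c) = c := by
  induction c <;> simp [encodeCode, ofNatCode, Nat.div2_val, *]

/-- The coding of oracle programs is a bijection with the natural numbers. -/
instance instDenumerable : Denumerable OCode :=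
  Denumerable.mk' ⟨encodeCode, ofNatCode, ofNat_encodeCode, encode_ofNatCode⟩

/-- The partial function computed by an oracle program when the oracle is the set `D`: the
instruction `oracle` maps `n` to `1` if `n ∈ D` and to `0` otherwise, and every other instruction
has the meaning that it has in `Nat.Partrec.Code.eval`. -/
noncomputable def eval (D : Set ℕ) : OCode → ℕ →. ℕ
  | zero => fun _ => Part.some 0
  | succ => fun n => Part.some (n + 1)
  | left => fun n => Part.some n.unpair.1
  | right => fun n => Part.some n.unpair.2
  | oracle => fun n => Part.some (D.indicator 1 n)
  | pair cf cg => fun n => Nat.pair <$> eval D cf n <*> eval D cg n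
  | comp cf cg => fun n => eval D cg n >>= eval D cf
  | prec cf cg =>
    Nat.unpaired fun a n =>
      n.rec (eval D cf a) fun y IH => do
        let i ← IH
        eval D cg (Nat.pair a (Nat.pair y i))
  | rfind' cf =>
    Nat.unpaired fun a m =>
      (Nat.rfind fun n => (fun m => m = 0) <$> eval D cf (Nat.pair a (n + m))).map (· + m)

end OCode

/-! ### Computably enumerable sets -/

/-- `W e` is the domain of the `e`-th partial computable function. -/
def W (e : ℕ) : Set ℕ :=
  {x | ((Denumerable.ofNat Nat.Partrec.Code e).eval x).Dom}

/-- `WIn D e` is the domain of the partial function computed by the `e`-th oracle program with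
oracle `D`. -/
def WIn (D : Set ℕ) (e : ℕ) : Set ℕ :=
  {x | ((Denumerable.ofNat OCode e).eval D x).Dom}

/-- The halting set `∅'`. -/
def zeroJump : Set ℕ := {e | e ∈ W e}

/-- The maximum of a set of natural numbers: `⊥` (that is, `-∞`) for the empty set and
`⊤` (that is, `+∞`) for an infinite set. -/
noncomputable def setMax (A : Set ℕ) : WithBot ℕ∞ :=
  ⨆ n ∈ A, ((n : ℕ∞) : WithBot ℕ∞)

/-! ### The equivalence relations -/

/-- Equality of the maxima of c.e. sets. -/
def EmaxCE (i j : ℕ) : Prop := setMax (W i) = setMax (W j)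

/-- Equality of the maxima of sets that are c.e. in `D`. -/
def EmaxIn (D : Set ℕ) (i j : ℕ) : Prop := setMax (WIn D i) = setMax (WIn D j)

/-- Equality of the cardinalities of sets that are c.e. in `D`. -/
def EcardIn (D : Set ℕ) (i j : ℕ) : Prop := (WIn D i).encard = (WIn D j).encard

/-! ### Arithmetical complexity of binary relations -/

/-- `R` is a `Π⁰₂` relation. -/
def IsPi2 (R : ℕ → ℕ → Prop) : Prop :=
  ∃ P : ℕ × ℕ × ℕ × ℕ → Bool, Computable P ∧
    ∀ i j, R i j ↔ ∀ a, ∃ b, P (i, j, a, b) = true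

/-- `R` is a `Π⁰₃` relation. -/
def IsPi3 (R : ℕ → ℕ → Prop) : Prop :=
  ∃ P : ℕ × ℕ × ℕ × ℕ × ℕ → Bool, Computable P ∧
    ∀ i j, R i j ↔ ∀ a, ∃ b, ∀ c, P (i, j, a, b, c) = true

/-- The characteristic function of a set, as an oracle. -/
noncomputable def charFun (D : Set ℕ) : ℕ →. ℕ := fun n => Part.some (D.indicator 1 n)

/-- `R` is `Π₂` relative to the oracle `D`. -/
def IsPi2In (D : Set ℕ) (R : ℕ → ℕ → Prop) : Prop :=
  ∃ P : ℕ × ℕ × ℕ × ℕ → Bool, ComputableIn {charFun D} P ∧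
    ∀ i j, R i j ↔ ∀ a, ∃ b, P (i, j, a, b) = true

/-! ### Reducibility and completeness -/

/-- `E` is `n`-arily reducible to `F`: there is a computable total function on `n`-tuples that
preserves and reflects the relation between any two coordinates. -/
def NaryReducible (n : ℕ) (E F : ℕ → ℕ → Prop) : Prop :=
  ∃ f : (Fin n → ℕ) → (Fin n → ℕ), Computable f ∧
    ∀ x : Fin n → ℕ, ∀ i j : Fin n, i < j → (E (x i) (x j) ↔ F (f x i) (f x j))

/-- `E` is complete under `n`-ary reducibility among the equivalence relations in the class `Γ`:
it is one of them, and every one of them is `n`-arily reducible to it. -/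
def IsNaryComplete (n : ℕ) (Γ : (ℕ → ℕ → Prop) → Prop) (E : ℕ → ℕ → Prop) : Prop :=
  Equivalence E ∧ Γ E ∧ ∀ R : ℕ → ℕ → Prop, Equivalence R → Γ R → NaryReducible n R E

end FinRed

namespace FinRed

open Encodable Denumerable
open Nat.Partrec (Code)

/-! ### Partial oracles and the use principle -/

namespace OCode

/-- Evaluation of an oracle program relative to a partial oracle. -/
def evalP (O : ℕ → Part ℕ) : OCode → ℕ → Part ℕ
  | zero => fun _ => Part.some 0
  | succ => fun n => Part.some (n + 1)
  | left => fun n => Part.some n.unpair.1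
  | right => fun n => Part.some n.unpair.2
  | oracle => O
  | pair cf cg => fun n => Nat.pair <$> evalP O cf n <*> evalP O cg n
  | comp cf cg => fun n => (evalP O cg n).bind (evalP O cf)
  | prec cf cg =>
    Nat.unpaired fun a n =>
      n.rec (evalP O cf a) fun y IH => do
        let i ← IH
        evalP O cg (Nat.pair a (Nat.pair y i))
  | rfind' cf =>
    Nat.unpaired fun a m =>
      (Nat.rfind fun n => (fun m => m = 0) <$> evalP O cf (Nat.pair a (n + m))).map (· + m)

theorem evalP_indicator (D : Set ℕ) (c : OCode) (n : ℕ) :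
    evalP (fun n => Part.some (D.indicator 1 n)) c n = eval D c n := by
  have h : evalP (fun n => Part.some (D.indicator 1 n)) c = eval D c := by
    induction c <;> simp only [evalP, eval, Part.bind_eq_bind, *] <;> rfl
  rw [h]

section

variable {O : ℕ → Part ℕ}

theorem evalP_pair (cf cg : OCode) (n : ℕ) : evalP O (pair cf cg) n =
    (evalP O cf n).bind fun a => (evalP O cg n).map (Nat.pair a) := by
  simp [evalP, Seq.seq]

theorem evalP_comp (cf cg : OCode) (n : ℕ) :
    evalP O (comp cf cg) n = (evalP O cg n).bind (evalP O cf) := rfl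

theorem evalP_prec_zero (cf cg : OCode) (a : ℕ) :
    evalP O (prec cf cg) (Nat.pair a 0) = evalP O cf a := by
  simp [evalP]

theorem evalP_prec_succ (cf cg : OCode) (a m : ℕ) :
    evalP O (prec cf cg) (Nat.pair a (m + 1)) = (evalP O (prec cf cg) (Nat.pair a m)).bind
      fun i => evalP O cg (Nat.pair a (Nat.pair m i)) := by
  simp [evalP]

theorem evalP_rfind' (cf : OCode) (a m : ℕ) :
    evalP O (rfind' cf) (Nat.pair a m) = (Nat.rfind fun n => (evalP O cf (Nat.pair a (n + m))).map
      fun m => decide (m = 0)).map (· + m) := by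
  simp [evalP]

theorem mem_evalP_rfind' {cf : OCode} {a m y : ℕ} :
    y ∈ evalP O (rfind' cf) (Nat.pair a m) ↔ ∃ n, y = n + m ∧ 0 ∈ evalP O cf (Nat.pair a (n + m)) ∧
      ∀ i < n, ∃ z ∈ evalP O cf (Nat.pair a (i + m)), z ≠ 0 := by
  rw [evalP_rfind', Part.mem_map_iff]
  refine exists_congr fun n => (and_congr_left' Nat.mem_rfind).trans ?_
  simp only [Part.mem_map_iff, decide_eq_true_eq, decide_eq_false_iff_not, exists_eq_right]
  tauto

end

/-- A halting computation receives a defined answer to each of its queries, so enlarging the oracle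
does not disturb it. -/
theorem evalP_mono {O O' : ℕ → Part ℕ} (h : ∀ n, ∀ y ∈ O n, y ∈ O' n) (c : OCode) :
    ∀ n, ∀ y ∈ evalP O c n, y ∈ evalP O' c n := by
  induction c with
  | zero | succ | left | right => exact fun _ _ h => h
  | oracle => exact h
  | pair cf cg hf hg =>
    intro n y hy
    simp only [evalP_pair, Part.mem_bind_iff, Part.mem_map_iff] at hy ⊢
    obtain ⟨a, ha, b, hb, rfl⟩ := hy
    exact ⟨a, hf _ _ ha, b, hg _ _ hb, rfl⟩
  | comp cf cg hf hg =>
    intro n y hy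
    simp only [evalP_comp, Part.mem_bind_iff] at hy ⊢
    obtain ⟨a, ha, hb⟩ := hy
    exact ⟨a, hg _ _ ha, hf _ _ hb⟩
  | prec cf cg hf hg =>
    intro n
    rw [← n.pair_unpair]
    generalize n.unpair.1 = a
    induction n.unpair.2 with
    | zero => simpa only [evalP_prec_zero] using hf a
    | succ m ih =>
      intro y hy
      simp only [evalP_prec_succ, Part.mem_bind_iff] at hy ⊢
      obtain ⟨i, hi, hy⟩ := hy
      exact ⟨i, ih _ hi, hg _ _ hy⟩
  | rfind' cf hf =>
    intro n y hy
    rw [← n.pair_unpair, mem_evalP_rfind'] at hy ⊢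
    obtain ⟨a, rfl, hb, h2⟩ := hy
    refine ⟨a, rfl, hf _ _ hb, fun m hm => ?_⟩
    obtain ⟨z, hz, hz0⟩ := h2 m hm
    exact ⟨z, hf _ _ hz, hz0⟩

/-- The use principle: a computation relative to an increasing union of partial oracles only
depends on one of them. -/
theorem exists_mem_evalP {O : ℕ → Part ℕ} {P : ℕ → ℕ → Part ℕ}
    (hP : ∀ k k', k ≤ k' → ∀ n, ∀ y ∈ P k n, y ∈ P k' n)
    (hO : ∀ n, ∀ y ∈ O n, ∃ k, y ∈ P k n) (c : OCode) :
    ∀ n, ∀ y ∈ evalP O c n, ∃ k, y ∈ evalP (P k) c n := by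
  have mono : ∀ c k k', k ≤ k' → ∀ n, ∀ y ∈ evalP (P k) c n, y ∈ evalP (P k') c n :=
    fun c k k' hk => evalP_mono (hP k k' hk) c
  induction c with
  | zero | succ | left | right => exact fun _ _ h => ⟨0, h⟩
  | oracle => exact hO
  | pair cf cg hf hg =>
    intro n y hy
    simp only [evalP_pair, Part.mem_bind_iff, Part.mem_map_iff] at hy ⊢
    obtain ⟨a, ha, b, hb, rfl⟩ := hy
    obtain ⟨k, hk⟩ := hf _ _ ha
    obtain ⟨l, hl⟩ := hg _ _ hb
    exact ⟨max k l, a, mono _ _ _ (le_max_left _ _) _ _ hk, b,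
      mono _ _ _ (le_max_right _ _) _ _ hl, rfl⟩
  | comp cf cg hf hg =>
    intro n y hy
    simp only [evalP_comp, Part.mem_bind_iff] at hy ⊢
    obtain ⟨a, ha, hb⟩ := hy
    obtain ⟨k, hk⟩ := hg _ _ ha
    obtain ⟨l, hl⟩ := hf _ _ hb
    exact ⟨max k l, a, mono _ _ _ (le_max_left _ _) _ _ hk, mono _ _ _ (le_max_right _ _) _ _ hl⟩
  | prec cf cg hf hg =>
    intro n
    rw [← n.pair_unpair]
    generalize n.unpair.1 = a
    induction n.unpair.2 with
    | zero => simpa only [evalP_prec_zero] using hf a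
    | succ m ih =>
      intro y hy
      simp only [evalP_prec_succ, Part.mem_bind_iff] at hy ⊢
      obtain ⟨i, hi, hy⟩ := hy
      obtain ⟨k, hk⟩ := ih _ hi
      obtain ⟨l, hl⟩ := hg _ _ hy
      exact ⟨max k l, i, mono _ _ _ (le_max_left _ _) _ _ hk,
        mono _ _ _ (le_max_right _ _) _ _ hl⟩
  | rfind' cf hf =>
    intro n y hy
    rw [← n.pair_unpair, mem_evalP_rfind'] at hy
    rw [← n.pair_unpair]
    simp only [mem_evalP_rfind']
    obtain ⟨a, rfl, hb, h2⟩ := hy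
    obtain ⟨k, hk⟩ := hf _ _ hb
    -- The search makes finitely many calls before it stops, so a single stage serves all of them.
    have h3 : ∀ m, ∃ l, m < a →
        ∃ z ∈ evalP (P l) cf (Nat.pair n.unpair.1 (m + n.unpair.2)), z ≠ 0 := by
      intro m
      by_cases hm : m < a
      · obtain ⟨z, hz, hz0⟩ := h2 m hm
        obtain ⟨l, hl⟩ := hf _ _ hz
        exact ⟨l, fun _ => ⟨z, hl, hz0⟩⟩
      · exact ⟨0, fun h => absurd h hm⟩
    choose l hl using h3
    refine ⟨max k ((Finset.range a).sup l), a, rfl, mono _ _ _ (le_max_left _ _) _ _ hk,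
      fun m hm => ?_⟩
    obtain ⟨z, hz, hz0⟩ := hl m hm
    exact ⟨z, mono _ _ _ (le_trans (Finset.le_sup (f := l) (Finset.mem_range.2 hm))
      (le_max_right _ _)) _ _ hz, hz0⟩

/-! ### Simulation of oracle programs by ordinary programs -/

/-- The partial oracle given by a list of answers. -/
def listOracle (σ : List ℕ) : ℕ → Part ℕ := fun n => (σ[n]? : Option ℕ)

theorem exists_listOracle_code : ∃ c : Code, ∀ (σ : List ℕ) (n : ℕ),
    c.eval (Nat.pair (encode σ) n) = listOracle σ n := by
  have h : Partrec fun p : ℕ => ((ofNat (List ℕ) p.unpair.1)[p.unpair.2]? : Part ℕ) :=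
    Computable.ofOption (Primrec.list_getElem?.comp ((Primrec.ofNat _).comp
      (Primrec.fst.comp Primrec.unpair)) (Primrec.snd.comp Primrec.unpair)).to_comp
  obtain ⟨c, hc⟩ := Code.exists_code.1 (Partrec.nat_iff.1 h)
  exact ⟨c, fun σ n => by simp [hc, listOracle]⟩

/-- A program that queries a list of answers. -/
noncomputable def lookupCode : Code := exists_listOracle_code.choose

theorem eval_lookupCode (σ : List ℕ) (n : ℕ) :
    lookupCode.eval (Nat.pair (encode σ) n) = listOracle σ n :=
  exists_listOracle_code.choose_spec σ n

/-- A program that maps `⟨s, ⟨a, n⟩⟩` to `⟨⟨s, a⟩, n⟩`. -/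
def assocCode : Code :=
  .pair (.pair .left (.comp .left .right)) (.comp .right .right)

/-- A program that maps `⟨⟨s, a⟩, n⟩` to `⟨s, ⟨a, n⟩⟩`. -/
def unassocCode : Code :=
  .pair (.comp .left .left) (.pair (.comp .right .left) .right)

theorem eval_comp (cf cg : Code) (n : ℕ) :
    (Code.comp cf cg).eval n = (cg.eval n).bind fun y => cf.eval y := rfl

theorem eval_pair (cf cg : Code) (n : ℕ) :
    (Code.pair cf cg).eval n = (cf.eval n).bind fun a => (cg.eval n).map (Nat.pair a) := by
  simp [Code.eval, Seq.seq]

theorem eval_left (n : ℕ) : Code.left.eval n = Part.some n.unpair.1 := rfl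

theorem eval_right (n : ℕ) : Code.right.eval n = Part.some n.unpair.2 := rfl

theorem eval_succ (n : ℕ) : Code.succ.eval n = Part.some (n + 1) := rfl

theorem eval_rfind' (cf : Code) (a m : ℕ) :
    (Code.rfind' cf).eval (Nat.pair a m) = (Nat.rfind fun n => (cf.eval (Nat.pair a (n + m))).map
      fun m => decide (m = 0)).map (· + m) := by
  simp [Code.eval]

theorem eval_assocCode (s a n : ℕ) :
    assocCode.eval (Nat.pair s (Nat.pair a n)) = Part.some (Nat.pair (Nat.pair s a) n) := by
  simp [assocCode, eval_comp, eval_pair, eval_left, eval_right]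

theorem eval_unassocCode (s a n : ℕ) :
    unassocCode.eval (Nat.pair (Nat.pair s a) n) = Part.some (Nat.pair s (Nat.pair a n)) := by
  simp [unassocCode, eval_comp, eval_pair, eval_left, eval_right]

/-- Translation of an oracle program to an ordinary program that takes a list of answers as an
additional argument. -/
noncomputable def toCode : OCode → Code
  | zero => .zero
  | succ => .comp .succ .right
  | left => .comp .left .right
  | right => .comp .right .right
  | oracle => lookupCode
  | pair cf cg => .pair (toCode cf) (toCode cg)
  | comp cf cg => .comp (toCode cf) (.pair .left (toCode cg))
  | prec cf cg => .comp (.prec (toCode cf) (.comp (toCode cg) unassocCode)) assocCode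
  | rfind' cf => .comp (.rfind' (.comp (toCode cf) unassocCode)) assocCode

theorem eval_toCode (σ : List ℕ) (c : OCode) :
    ∀ n, (toCode c).eval (Nat.pair (encode σ) n) = evalP (listOracle σ) c n := by
  induction c with
  | zero => exact fun _ => rfl
  | succ | left | right =>
    intro n
    simp [toCode, evalP, eval_comp, eval_right, eval_succ, eval_left]
  | oracle => exact eval_lookupCode σ
  | pair cf cg hf hg => intro n; simp only [toCode, eval_pair, evalP_pair, hf, hg]
  | comp cf cg hf hg =>
    intro n
    simp only [toCode, eval_comp, eval_pair, eval_left, evalP_comp, hg, Part.bind_map, hf,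
      Nat.unpair_pair, Part.bind_some]
  | prec cf cg hf hg =>
    intro n
    rw [← n.pair_unpair, toCode, eval_comp, eval_assocCode, Part.bind_some]
    generalize n.unpair.1 = a
    induction n.unpair.2 with
    | zero => rw [Code.eval_prec_zero, evalP_prec_zero, hf]
    | succ m ih =>
      rw [Code.eval_prec_succ, ih, evalP_prec_succ]
      simp only [eval_comp, eval_unassocCode, Part.bind_some, hg, Part.bind_eq_bind]
  | rfind' cf hf =>
    intro n
    rw [← n.pair_unpair, toCode, eval_comp, eval_assocCode, Part.bind_some, eval_rfind',
      evalP_rfind']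
    simp only [eval_comp, eval_unassocCode, Part.bind_some, hf]

theorem ofNatCode_eq : ofNat OCode = ofNatCode := rfl

/-- Course-of-values recursion on the code number: the translations of the immediate subprograms are
read off the list of earlier values. -/
theorem primrec_toCode : Primrec fun n : ℕ => toCode (ofNat OCode n) := by
  -- The arguments are the earlier values, `n` for the code number `n + 5`, and `n.div2.div2`, which
  -- codes the subprograms; the two low bits of `n` select the constructor.
  let G₁ : List Code × ℕ × ℕ → Option Code := fun p =>
    p.1[p.2.2]?.bind fun s => p.1[p.2.2.unpair.1]?.bind fun s₁ => p.1[p.2.2.unpair.2]?.map fun s₂ =>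
    cond p.2.1.bodd
      (cond p.2.1.div2.bodd (.comp (.rfind' (.comp s unassocCode)) assocCode)
        (.comp (.prec s₁ (.comp s₂ unassocCode)) assocCode))
      (cond p.2.1.div2.bodd (.comp s₁ (.pair .left s₂)) (.pair s₁ s₂))
  have h₁ : Primrec G₁ := by
    refine Primrec.option_bind (Primrec.list_getElem?.comp Primrec.fst
      (Primrec.snd.comp Primrec.snd)) <| .mk ?_
    refine Primrec.option_bind ((Primrec.list_getElem?.comp Primrec.fst
      (Primrec.fst.comp <| Primrec.unpair.comp (Primrec.snd.comp Primrec.snd))).comp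
        Primrec.fst) <| .mk ?_
    refine Primrec.option_map ((Primrec.list_getElem?.comp Primrec.fst
      (Primrec.snd.comp <| Primrec.unpair.comp (Primrec.snd.comp Primrec.snd))).comp
        (Primrec.fst.comp Primrec.fst)) <| .mk ?_
    have n : Primrec fun p : (((List Code × ℕ × ℕ) × Code) × Code) × Code => p.1.1.1.2.1 :=
      Primrec.fst.comp (Primrec.snd.comp (Primrec.fst.comp (Primrec.fst.comp Primrec.fst)))
    have s : Primrec fun p : (((List Code × ℕ × ℕ) × Code) × Code) × Code => p.1.1.2 :=
      Primrec.snd.comp (Primrec.fst.comp Primrec.fst)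
    have s₁ : Primrec fun p : (((List Code × ℕ × ℕ) × Code) × Code) × Code => p.1.2 :=
      Primrec.snd.comp Primrec.fst
    have s₂ : Primrec fun p : (((List Code × ℕ × ℕ) × Code) × Code) × Code => p.2 := Primrec.snd
    have c := fun c : Code =>
      Primrec.const (α := (((List Code × ℕ × ℕ) × Code) × Code) × Code) c
    exact (Primrec.nat_bodd.comp n).cond
      ((Primrec.nat_bodd.comp (Primrec.nat_div2.comp n)).cond
        (Code.primrec₂_comp.comp (Code.primrec_rfind'.comp
          (Code.primrec₂_comp.comp s (c _))) (c _))
        (Code.primrec₂_comp.comp (Code.primrec₂_prec.comp s₁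
          (Code.primrec₂_comp.comp s₂ (c _))) (c _)))
      ((Primrec.nat_bodd.comp (Primrec.nat_div2.comp n)).cond
        (Code.primrec₂_comp.comp s₁ (Code.primrec₂_pair.comp (c _) s₂))
        (Code.primrec₂_pair.comp s₁ s₂))
  let G : Unit → List Code → Option Code := fun _ IH =>
    IH.length.casesOn (some (toCode zero)) fun n =>
    n.casesOn (some (toCode succ)) fun n =>
    n.casesOn (some (toCode left)) fun n =>
    n.casesOn (some (toCode right)) fun n =>
    n.casesOn (some (toCode oracle)) fun n =>
    G₁ (IH, n, n.div2.div2)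
  have hG : Primrec₂ G := .mk <|
    Primrec.nat_casesOn (Primrec.list_length.comp Primrec.snd) (Primrec.const _) <| .mk <|
    Primrec.nat_casesOn Primrec.snd (Primrec.const _) <| .mk <|
    Primrec.nat_casesOn Primrec.snd (Primrec.const _) <| .mk <|
    Primrec.nat_casesOn Primrec.snd (Primrec.const _) <| .mk <|
    Primrec.nat_casesOn Primrec.snd (Primrec.const _) <| .mk <|
    h₁.comp <| (Primrec.snd.comp <| Primrec.fst.comp <| Primrec.fst.comp <| Primrec.fst.comp <|
      Primrec.fst.comp Primrec.fst).pair <|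
      Primrec.snd.pair <| Primrec.nat_div2.comp <| Primrec.nat_div2.comp Primrec.snd
  refine (Primrec.nat_strong_rec (fun (_ : Unit) n => toCode (ofNat OCode n)) hG
    fun a n => ?_).comp (Primrec.const ()) Primrec.id
  iterate 5 rcases n with - | n; · simp [G, ofNatCode_eq, ofNatCode]; try rfl
  simp only [G]
  rw [List.length_map, List.length_range]
  let m := n.div2.div2
  change G₁ ((List.range (n + 5)).map fun n => toCode (ofNat OCode n), n, m)
    = some (toCode (ofNat OCode (n + 5)))
  have hm : m < n + 5 := by
    simp only [m, Nat.div2_val]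
    exact lt_of_le_of_lt
      (le_trans (Nat.div_le_self ..) (Nat.div_le_self ..))
      (Nat.succ_le_succ (Nat.le_add_right ..))
  have m1 : m.unpair.1 < n + 5 := lt_of_le_of_lt m.unpair_left_le hm
  have m2 : m.unpair.2 < n + 5 := lt_of_le_of_lt m.unpair_right_le hm
  simp [G₁, m, hm, m1, m2]
  rw [show ofNat OCode (n + 5) = ofNatCode (n + 5) from rfl]
  simp [ofNatCode]
  cases n.bodd <;> cases n.div2.bodd <;> rfl

end OCode

/-! ### Sets that are c.e. relative to an oracle -/

/-- The list of the first `k` values of the characteristic function of `D`. -/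
noncomputable def restr (D : Set ℕ) (k : ℕ) : List ℕ := (List.range k).map (D.indicator 1)

theorem length_restr (D : Set ℕ) (k : ℕ) : (restr D k).length = k := by simp [restr]

theorem take_restr (D : Set ℕ) {k l : ℕ} (h : k ≤ l) : (restr D l).take k = restr D k := by
  rw [restr, restr, ← List.map_take, List.take_range, min_eq_left h]

theorem restr_succ (D : Set ℕ) (k : ℕ) : restr D (k + 1) = restr D k ++ [D.indicator 1 k] := by
  simp [restr, List.range_succ]

theorem getElem?_restr (D : Set ℕ) (k n : ℕ) :
    (restr D k)[n]? = if n < k then some (D.indicator 1 n) else none := by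
  split_ifs with h
  · simp [restr, h]
  · simp [restr]; omega

variable {α β : Type} [Primcodable α] [Primcodable β] {D : Set ℕ}

theorem primrecPred_exists_lt {Q : α × ℕ → Prop} (hQ : PrimrecPred Q) {f : α → ℕ}
    (hf : Primrec f) : PrimrecPred fun x => ∃ t < f x, Q (x, t) := by
  have h : PrimrecRel fun (t : ℕ) (x : α) => Q (x, t) :=
    PrimrecPred.comp hQ (Primrec.snd.pair Primrec.fst)
  exact (h.exists_mem_list.comp (Primrec.list_range.comp hf) Primrec.id).of_eq (by simp)

theorem primrecPred_forall_lt {Q : α × ℕ → Prop} (hQ : PrimrecPred Q) {f : α → ℕ}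
    (hf : Primrec f) : PrimrecPred fun x => ∀ t < f x, Q (x, t) := by
  have h : PrimrecRel fun (t : ℕ) (x : α) => Q (x, t) :=
    PrimrecPred.comp hQ (Primrec.snd.pair Primrec.fst)
  exact (h.forall_mem_list.comp (Primrec.list_range.comp hf) Primrec.id).of_eq (by simp)

theorem primrec_evaln {k n : α → ℕ} {c : α → Code} (hk : Primrec k) (hc : Primrec c)
    (hn : Primrec n) : Primrec fun a => Code.evaln (k a) (c a) (n a) :=
  Code.primrec_evaln.comp ((hk.pair hc).pair hn)

/-- `A` is c.e. in `D`, in normal form: membership is witnessed by a finite part of the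
characteristic function of `D`. -/
def REIn (D : Set ℕ) (A : α → Prop) : Prop :=
  ∃ Q : α × List ℕ → Prop, PrimrecPred Q ∧
    (∀ x k l, k ≤ l → Q (x, restr D k) → Q (x, restr D l)) ∧ ∀ x, A x ↔ ∃ k, Q (x, restr D k)

namespace REIn

theorem of_eq {A B : α → Prop} (hA : REIn D A) (h : ∀ x, A x ↔ B x) : REIn D B :=
  (funext fun x => propext (h x) : A = B) ▸ hA

/-- Brings a witness that need not be monotone into normal form: a prefix is accepted once some
shorter or equal prefix and some `t` up to its length are accepted. -/
theorem mk {A : α → Prop} {Q : (α × ℕ) × List ℕ → Prop} (hQ : PrimrecPred Q)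
    (hA : ∀ x, A x ↔ ∃ t k, Q ((x, t), restr D k)) : REIn D A := by
  have h : PrimrecPred fun q : ((α × List ℕ) × ℕ) × ℕ => Q ((q.1.1.1, q.2), q.1.1.2.take q.1.2) :=
    hQ.comp (((Primrec.fst.comp (Primrec.fst.comp Primrec.fst)).pair Primrec.snd).pair
      (Primrec.list_take.comp (Primrec.snd.comp Primrec.fst)
        (Primrec.snd.comp (Primrec.fst.comp Primrec.fst))))
  have hl : Primrec fun p : α × List ℕ => p.2.length + 1 :=
    Primrec.succ.comp (Primrec.list_length.comp Primrec.snd)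
  refine ⟨fun p => ∃ k < p.2.length + 1, ∃ t < p.2.length + 1, Q ((p.1, t), p.2.take k),
    primrecPred_exists_lt (primrecPred_exists_lt h (hl.comp Primrec.fst)) hl,
    ?_, fun x => ?_⟩
  · rintro x k l hkl ⟨i, hi, t, ht, hq⟩
    simp only [length_restr] at hi ht hq ⊢
    rw [take_restr _ (by omega)] at hq
    exact ⟨i, by omega, t, by omega, by rwa [take_restr _ (by omega)]⟩
  · rw [hA]
    constructor
    · rintro ⟨t, k, hq⟩
      refine ⟨max t k, k, ?_, t, ?_, ?_⟩
      · simp [length_restr]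
      · simp [length_restr]
      · simpa [take_restr D (le_max_right t k)] using hq
    · rintro ⟨l, k, hk, t, ht, hq⟩
      rw [length_restr] at hk
      rw [take_restr _ (by omega)] at hq
      exact ⟨t, k, hq⟩

theorem comp {A : β → Prop} (hA : REIn D A) {f : α → β} (hf : Primrec f) :
    REIn D fun x => A (f x) := by
  obtain ⟨Q, hQ, hm, hA⟩ := hA
  exact ⟨fun p => Q (f p.1, p.2), hQ.comp ((hf.comp Primrec.fst).pair Primrec.snd),
    fun x => hm (f x), fun x => hA (f x)⟩

theorem of_primrecPred {A : α → Prop} (hA : PrimrecPred A) : REIn D A :=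
  ⟨fun p => A p.1, hA.comp Primrec.fst, fun _ _ _ _ => id, fun _ => by simp⟩

protected theorem and {A B : α → Prop} (hA : REIn D A) (hB : REIn D B) :
    REIn D fun x => A x ∧ B x := by
  obtain ⟨Q, hQ, hm, hA⟩ := hA
  obtain ⟨S, hS, hn, hB⟩ := hB
  refine ⟨fun p => Q p ∧ S p, hQ.and hS,
    fun x k l h => And.imp (hm x k l h) (hn x k l h), fun x => ?_⟩
  simp only [hA, hB]
  exact ⟨fun ⟨⟨k, hk⟩, l, hl⟩ => ⟨max k l, hm _ _ _ (le_max_left _ _) hk,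
    hn _ _ _ (le_max_right _ _) hl⟩, fun ⟨k, h⟩ => ⟨⟨k, h.1⟩, k, h.2⟩⟩

protected theorem or {A B : α → Prop} (hA : REIn D A) (hB : REIn D B) :
    REIn D fun x => A x ∨ B x := by
  obtain ⟨Q, hQ, hm, hA⟩ := hA
  obtain ⟨S, hS, hn, hB⟩ := hB
  refine ⟨fun p => Q p ∨ S p, hQ.or hS,
    fun x k l h => Or.imp (hm x k l h) (hn x k l h), fun x => ?_⟩
  simp only [hA, hB, exists_or]

theorem exists_nat {A : α × ℕ → Prop} (hA : REIn D A) : REIn D fun x => ∃ n, A (x, n) := by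
  obtain ⟨Q, hQ, -, hA⟩ := hA
  exact mk hQ fun x => exists_congr fun n => hA (x, n)

/-- Monotonicity in the prefix lets the longest of finitely many witnessing prefixes serve all
instances. -/
theorem forall_lt {A : α × ℕ → Prop} (hA : REIn D A) :
    REIn D fun p : α × ℕ => ∀ i < p.2, A (p.1, i) := by
  obtain ⟨Q, hQ, hm, hA⟩ := hA
  have h : PrimrecPred fun q : ((α × ℕ) × List ℕ) × ℕ => Q ((q.1.1.1, q.2), q.1.2) :=
    hQ.comp (((Primrec.fst.comp (Primrec.fst.comp Primrec.fst)).pair Primrec.snd).pair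
      (Primrec.snd.comp Primrec.fst))
  refine ⟨fun p => ∀ i < p.1.2, Q ((p.1.1, i), p.2),
    primrecPred_forall_lt h (Primrec.snd.comp Primrec.fst),
    fun x k l hkl hq i hi => hm _ _ _ hkl (hq i hi), fun x => ?_⟩
  simp only [hA]
  refine ⟨fun h => ?_, fun ⟨k, hk⟩ i hi => ⟨k, hk i hi⟩⟩
  have : ∀ i, ∃ k, i < x.2 → Q ((x.1, i), restr D k) := fun i => by
    by_cases hi : i < x.2
    · exact (h i hi).imp fun _ h _ => h
    · exact ⟨0, fun h => absurd h hi⟩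
  choose k hk using this
  exact ⟨(Finset.range x.2).sup k, fun i hi =>
    hm _ _ _ (Finset.le_sup (f := k) (Finset.mem_range.2 hi)) (hk i hi)⟩

theorem of_mem_eval :
    REIn D fun p : (Code × ℕ) × ℕ => p.2 ∈ p.1.1.eval p.1.2 := by
  refine mk (Q := fun q => Code.evaln q.1.2 q.1.1.1.1 q.1.1.1.2 = some q.1.1.2) ?_ fun x => ?_
  · exact Primrec.eq.comp (primrec_evaln (Primrec.snd.comp Primrec.fst)
      (Primrec.fst.comp (Primrec.fst.comp (Primrec.fst.comp Primrec.fst)))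
      (Primrec.snd.comp (Primrec.fst.comp (Primrec.fst.comp Primrec.fst))))
      (Primrec.option_some.comp (Primrec.snd.comp (Primrec.fst.comp Primrec.fst)))
  · simp [Code.evaln_complete]

theorem of_notMem : REIn D fun n => n ∉ D := by
  refine mk (Q := fun q => q.2[q.1.1]? = some 0) ?_ fun n => ?_
  · exact Primrec.eq.comp (Primrec.list_getElem?.comp Primrec.snd (Primrec.fst.comp Primrec.fst))
      (Primrec.const _)
  · simp only [getElem?_restr]
    constructor
    · intro h
      exact ⟨0, n + 1, by simp [h]⟩
    · rintro ⟨_, k, h⟩ hn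
      split_ifs at h
      simp [hn] at h

/-- The graph of the universal function relative to `D` is c.e. in `D`. -/
theorem of_mem_oeval :
    REIn D fun p : (ℕ × ℕ) × ℕ => p.2 ∈ (ofNat OCode p.1.1).eval D p.1.2 := by
  -- By the use principle a prefix of `D` suffices for the computation; the number `t` of `mk`
  -- bounds the running time of its simulation.
  refine mk (Q := fun q => Code.evaln q.1.2 (ofNat OCode q.1.1.1.1).toCode
    (Nat.pair (encode q.2) q.1.1.1.2) = some q.1.1.2) ?_ fun x => ?_
  · exact Primrec.eq.comp (primrec_evaln (Primrec.snd.comp Primrec.fst)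
      (OCode.primrec_toCode.comp
        (Primrec.fst.comp (Primrec.fst.comp (Primrec.fst.comp Primrec.fst))))
      (Primrec₂.natPair.comp (Primrec.encode.comp Primrec.snd)
        (Primrec.snd.comp (Primrec.fst.comp (Primrec.fst.comp Primrec.fst)))))
      (Primrec.option_some.comp (Primrec.snd.comp (Primrec.fst.comp Primrec.fst)))
  · have hO : ∀ k n y, y ∈ OCode.listOracle (restr D k) n ↔ n < k ∧ y = D.indicator 1 n := by
      intro k n y
      rw [OCode.listOracle, getElem?_restr]
      split_ifs with h <;> simp [h]
    have : x.2 ∈ (ofNat OCode x.1.1).eval D x.1.2 ↔ ∃ k,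
        x.2 ∈ OCode.evalP (OCode.listOracle (restr D k)) (ofNat OCode x.1.1) x.1.2 := by
      rw [← OCode.evalP_indicator]
      constructor
      · refine OCode.exists_mem_evalP (fun k l hkl n y hy => ?_) (fun n y hy => ⟨n + 1, ?_⟩) _ _ _
        · rw [hO] at hy ⊢
          exact ⟨by omega, hy.2⟩
        · rw [hO]
          exact ⟨by omega, by simpa [] using hy⟩
      · rintro ⟨k, hk⟩
        refine OCode.evalP_mono (fun n y hy => ?_) _ _ _ hk
        rw [hO] at hy
        simp [hy.2]
    rw [this, exists_comm]
    refine exists_congr fun k => ?_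
    rw [← OCode.eval_toCode, Code.evaln_complete]
    rfl

theorem of_mem_WIn : REIn D fun p : ℕ × ℕ => p.2 ∈ WIn D p.1 :=
  (of_mem_oeval (D := D)).exists_nat.of_eq fun p => by
    rw [WIn, Set.mem_ofPred_eq, Part.dom_iff_mem]

end REIn

/-! ### Oracle programs for functions that are recursive in the oracle -/

namespace OCode

theorem exists_code {f : ℕ →. ℕ} (hf : Nat.RecursiveIn {charFun D} f) :
    ∃ c : OCode, ∀ n, c.eval D n = f n := by
  induction hf with
  | zero => exact ⟨zero, fun _ => rfl⟩
  | succ => exact ⟨succ, fun _ => rfl⟩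
  | left => exact ⟨left, fun _ => rfl⟩
  | right => exact ⟨right, fun _ => rfl⟩
  | oracle g hg => exact ⟨oracle, fun _ => by rw [Set.mem_singleton_iff.1 hg]; rfl⟩
  | pair _ _ hf hg =>
    obtain ⟨cf, hf⟩ := hf
    obtain ⟨cg, hg⟩ := hg
    exact ⟨pair cf cg, fun n => by simp only [eval, hf, hg]⟩
  | comp _ _ hf hg =>
    obtain ⟨cf, hf⟩ := hf
    obtain ⟨cg, hg⟩ := hg
    exact ⟨comp cf cg, fun n => by simp only [eval, hg, funext hf]⟩
  | prec _ _ hf hg =>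
    obtain ⟨cf, hf⟩ := hf
    obtain ⟨cg, hg⟩ := hg
    exact ⟨prec cf cg, fun n => by simp only [eval, hf, hg, Nat.unpaired]⟩
  | rfind _ hf =>
    obtain ⟨cf, hf⟩ := hf
    -- `rfind'` starts its search at the second component of its input, so the input `n` is first
    -- replaced by `⟨n, 0⟩`.
    refine ⟨comp (rfind' cf) (pair (pair left right) zero), fun n => ?_⟩
    have h : evalP (fun n => Part.some (D.indicator 1 n)) (pair (pair left right) zero) n =
        Part.some (Nat.pair n 0) := by
      simp only [evalP_pair]
      simp [evalP]
    rw [← evalP_indicator, evalP_comp, h, Part.bind_some, evalP_rfind']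
    simp [evalP_indicator, hf, Part.map_id']

/-- The code number of a constant program. -/
def constNum : ℕ → ℕ
  | 0 => 0
  | n + 1 => 2 * (2 * Nat.pair 1 (constNum n) + 1) + 5

theorem eval_constNum (n x : ℕ) : (ofNat OCode (constNum n)).eval D x = Part.some n := by
  have h : ∀ n, ∃ c : OCode, encodeCode c = constNum n ∧ c.eval D x = Part.some n := by
    intro n
    induction n with
    | zero => exact ⟨zero, rfl, rfl⟩
    | succ n ih =>
      obtain ⟨c, hc, h⟩ := ih
      refine ⟨comp succ c, by simp [encodeCode, constNum, hc], ?_⟩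
      rw [← evalP_indicator, evalP_comp, evalP_indicator, h]
      simp [evalP]
  obtain ⟨c, hc, h⟩ := h n
  rw [← hc, ofNatCode_eq, ofNat_encodeCode, h]

theorem primrec_constNum : Primrec constNum :=
  (Primrec.nat_rec₁ 0 (f := fun _ m => 2 * (2 * Nat.pair 1 m + 1) + 5)
    (Primrec.nat_add.comp (Primrec.nat_double.comp (Primrec.nat_double_succ.comp
      (Primrec₂.natPair.comp (Primrec.const 1) Primrec.snd))) (Primrec.const 5))).of_eq fun n => by
    induction n with
    | zero => rfl
    | succ n ih => simp only [constNum, ih]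

/-- The code number of the program that fixes the first argument `n` of the program `c`. -/
def curryNum (c : OCode) (n : ℕ) : ℕ :=
  2 * (2 * Nat.pair (encodeCode c) (2 * (2 * Nat.pair (constNum n)
    (encodeCode (pair left right))) + 5) + 1) + 5

theorem eval_curryNum (c : OCode) (n x : ℕ) :
    (ofNat OCode (curryNum c n)).eval D x = c.eval D (Nat.pair n x) := by
  -- `pair left right` is the identity program.
  have h : curryNum c n =
      encodeCode (comp c (pair (ofNat OCode (constNum n)) (pair left right))) := by
    simp [curryNum, encodeCode, ofNatCode_eq, encode_ofNatCode]
  rw [h, show ofNat OCode (encodeCode _) = _ from ofNat_encodeCode _, ← evalP_indicator, evalP_comp,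
    evalP_pair, evalP_indicator, eval_constNum]
  simp only [evalP_pair, ← evalP_indicator]
  simp [evalP]

theorem primrec_curryNum (c : OCode) : Primrec (curryNum c) :=
  Primrec.nat_add.comp (Primrec.nat_double.comp (Primrec.nat_double_succ.comp
    (Primrec₂.natPair.comp (Primrec.const _) (Primrec.nat_add.comp (Primrec.nat_double.comp
      (Primrec.nat_double.comp (Primrec₂.natPair.comp primrec_constNum (Primrec.const _))))
      (Primrec.const 5))))) (Primrec.const 5)

end OCode

/-! ### Functions that depend on a finite part of the oracle -/

section

variable {O : Set (ℕ →. ℕ)} {f g : ℕ → ℕ}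

theorem recursiveIn_pair (hf : Nat.RecursiveIn O fun n => Part.some (f n))
    (hg : Nat.RecursiveIn O fun n => Part.some (g n)) :
    Nat.RecursiveIn O fun n => Part.some (Nat.pair (f n) (g n)) :=
  (hf.pair hg).of_eq fun n => by simp [Seq.seq]

theorem recursiveIn_comp {f : ℕ → Part ℕ} (hf : Nat.RecursiveIn O f)
    (hg : Nat.RecursiveIn O fun n => Part.some (g n)) :
    Nat.RecursiveIn O fun n => f (g n) :=
  (hf.comp hg).of_eq fun _ => Part.bind_some _ _

theorem recursiveIn_comp_some (hf : Nat.RecursiveIn O fun n => Part.some (f n))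
    (hg : Nat.RecursiveIn O fun n => Part.some (g n)) :
    Nat.RecursiveIn O fun n => Part.some (f (g n)) :=
  recursiveIn_comp (f := fun n => Part.some (f n)) hf hg

theorem recursiveIn_prec (hf : Nat.RecursiveIn O fun n => Part.some (f n))
    (hg : Nat.RecursiveIn O fun n => Part.some (g n)) :
    Nat.RecursiveIn O fun n => Part.some (n.unpair.2.rec (f n.unpair.1)
      fun y i => g (Nat.pair n.unpair.1 (Nat.pair y i)) : ℕ) := by
  refine (hf.prec hg).of_eq fun n => ?_
  simp only
  induction n.unpair.2 with
  | zero => rfl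
  | succ k ih =>
    simp only [ih]
    exact Part.bind_some _ _

theorem recursiveIn_primrec (hf : Primrec f) : Nat.RecursiveIn O fun n => Part.some (f n) :=
  (Primrec.nat_iff.1 hf).recursiveIn

end

/-- Primitive recursion on the length, with one oracle query appended at each step. -/
theorem recursiveIn_restr :
    Nat.RecursiveIn {charFun D} fun k => Part.some (encode (restr D k)) := by
  have hs : Primrec fun n : ℕ => encode (ofNat (List ℕ) n.unpair.2 ++ [n.unpair.1]) :=
    Primrec.encode.comp (Primrec.list_concat.comp ((Primrec.ofNat _).comp
      (Primrec.snd.comp Primrec.unpair)) (Primrec.fst.comp Primrec.unpair))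
  have ho : Nat.RecursiveIn {charFun D} fun n => Part.some (D.indicator 1 n) :=
    Nat.RecursiveIn.oracle (charFun D) rfl
  have h1 : Primrec fun n : ℕ => n.unpair.2.unpair.1 :=
    Primrec.fst.comp (Primrec.unpair.comp (Primrec.snd.comp Primrec.unpair))
  have h2 : Primrec fun n : ℕ => n.unpair.2.unpair.2 :=
    Primrec.snd.comp (Primrec.unpair.comp (Primrec.snd.comp Primrec.unpair))
  have h := recursiveIn_comp_some (recursiveIn_prec
    (recursiveIn_primrec (Primrec.const (encode ([] : List ℕ))))
    (recursiveIn_comp_some (recursiveIn_primrec hs) (recursiveIn_pair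
      (recursiveIn_comp_some ho (recursiveIn_primrec h1)) (recursiveIn_primrec h2))))
    (recursiveIn_primrec (Primrec₂.natPair.comp (Primrec.const 0) Primrec.id))
  refine h.of_eq fun k => congrArg Part.some ?_
  simp only [Nat.unpair_pair, id]
  induction k with
  | zero => rfl
  | succ k ih => simp only [ih, ofNat_encode, restr_succ]

/-- A primitive recursive function of a finite part of the oracle is computable in the oracle. -/
theorem computableIn_restr {h : α × List ℕ → β} (hh : Primrec h) {κ : α → ℕ} (hκ : Primrec κ) :
    ComputableIn {charFun D} fun x => h (x, restr D (κ x)) := by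
  have h1 : Primrec fun n : ℕ => ((decode n : Option α).map κ).getD 0 :=
    Primrec.option_getD.comp (Primrec.option_map Primrec.decode
      (hκ.comp Primrec.snd).to₂) (Primrec.const 0)
  have h2 : Partrec fun n : ℕ => (((decode n.unpair.1 : Option α).map fun a =>
      encode (h (a, ofNat (List ℕ) n.unpair.2)) : Option ℕ) : Part ℕ) :=
    Computable.ofOption (Primrec.option_map (Primrec.decode.comp (Primrec.fst.comp
      Primrec.unpair)) (Primrec.encode.comp (hh.comp (Primrec.snd.pair ((Primrec.ofNat _).comp
      (Primrec.snd.comp (Primrec.unpair.comp Primrec.fst)))))).to₂).to_comp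
  refine (recursiveIn_comp (Partrec.nat_iff.1 h2).recursiveIn
    (recursiveIn_pair (recursiveIn_primrec Primrec.id)
      (recursiveIn_comp_some recursiveIn_restr (recursiveIn_primrec h1)))).of_eq fun n => ?_
  cases e : (decode n : Option α) <;> simp [e]

theorem rfind_some_dom {p : ℕ → Bool} :
    (Nat.rfind fun n => Part.some (p n)).Dom ↔ ∃ n, p n = true :=
  Nat.rfind_dom.trans (by simp)

/-- The parametrisation theorem: a uniformly c.e. family in `D` has a primitive recursive sequence
of indices. -/
theorem REIn.exists_index {A : α × ℕ → Prop} (hA : REIn D A) :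
    ∃ g : α → ℕ, Primrec g ∧ ∀ a n, n ∈ WIn D (g a) ↔ A (a, n) := by
  obtain ⟨Q, ⟨_, hQ⟩, -, hA⟩ := hA
  -- The input is `⟨⟨a, n⟩, k⟩`. The value `0` ends the unbounded search for `k`; the default `1`
  -- makes the search diverge on inputs that code no element of `α`.
  let h : ℕ × List ℕ → ℕ := fun p => ((decode p.1.unpair.1.unpair.1 : Option α).map fun a =>
    cond (decide (Q ((a, p.1.unpair.1.unpair.2), p.2))) 0 1).getD 1
  have hh : Primrec h := by
    have u : Primrec fun p : ℕ × List ℕ => p.1.unpair.1.unpair :=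
      Primrec.unpair.comp (Primrec.fst.comp (Primrec.unpair.comp Primrec.fst))
    have hq : Primrec fun q : (ℕ × List ℕ) × α => ((q.2, q.1.1.unpair.1.unpair.2), q.1.2) :=
      (Primrec.snd.pair (Primrec.snd.comp (u.comp Primrec.fst))).pair
        (Primrec.snd.comp Primrec.fst)
    have hc : Primrec₂ fun (p : ℕ × List ℕ) (a : α) =>
        cond (decide (Q ((a, p.1.unpair.1.unpair.2), p.2))) 0 1 :=
      (Primrec.cond (hQ.comp hq) (Primrec.const 0) (Primrec.const 1)).to₂
    exact Primrec.option_getD.comp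
      (Primrec.option_map (Primrec.decode.comp (Primrec.fst.comp u)) hc) (Primrec.const 1)
  have hc : Nat.RecursiveIn {charFun D} fun N => Part.some (h (N, restr D N.unpair.2)) :=
    RecursiveIn.iff_nat.1 (computableIn_restr hh (Primrec.snd.comp Primrec.unpair))
  obtain ⟨c, hc⟩ := OCode.exists_code hc.rfind
  refine ⟨fun a => OCode.curryNum c (encode a), (OCode.primrec_curryNum c).comp Primrec.encode,
    fun a n => ?_⟩
  rw [WIn, Set.mem_ofPred_eq, OCode.eval_curryNum, hc, hA]
  simp only [Part.map_eq_map, Part.map_some]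
  refine rfind_some_dom.trans (exists_congr fun k => ?_)
  simp only [Nat.unpair_pair, encodek, h, Option.map_some, Option.getD_some]
  by_cases hq : Q ((a, n), restr D k) <;> simp [hq]

theorem REIn.of_computableIn {P : α → Bool} (hP : ComputableIn {charFun D} P) :
    REIn D fun x => P x = true := by
  obtain ⟨c, hc⟩ := OCode.exists_code hP
  -- The output `1` is the code of `true`.
  have hf : Primrec fun x : α => ((OCode.encodeCode c, encode x), 1) :=
    ((Primrec.const _).pair Primrec.encode).pair (Primrec.const _)
  refine (REIn.of_mem_oeval.comp hf).of_eq fun x => ?_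
  rw [OCode.ofNatCode_eq, OCode.ofNat_encodeCode, hc]
  cases h : P x <;> simp [h]

/-! ### `Π₂` predicates relative to an oracle -/

/-- `A` is `Π₂` in `D`. -/
def Pi2In (D : Set ℕ) (A : α → Prop) : Prop :=
  ∃ B : α × ℕ → Prop, REIn D B ∧ ∀ x, A x ↔ ∀ n, B (x, n)

theorem REIn.pi2In {A : α → Prop} (hA : REIn D A) : Pi2In D A :=
  ⟨fun p => A p.1, hA.comp Primrec.fst, fun _ => by simp⟩

/-- Non-membership says that every prefix fails to be a witness, and each single failure is
recognised from any sufficiently long prefix. -/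
theorem REIn.pi2In_not {A : α → Prop} (hA : REIn D A) : Pi2In D fun x => ¬ A x := by
  obtain ⟨Q, hQ, -, hA⟩ := hA
  refine ⟨_, REIn.mk (Q := fun q : ((α × ℕ) × ℕ) × List ℕ =>
    q.1.1.2 < q.2.length ∧ ¬ Q (q.1.1.1, q.2.take q.1.1.2)) ?_ (fun _ => Iff.rfl), fun x => ?_⟩
  · have hn : Primrec fun q : ((α × ℕ) × ℕ) × List ℕ => q.1.1.2 :=
      Primrec.snd.comp (Primrec.fst.comp Primrec.fst)
    exact (Primrec.nat_lt.comp hn (Primrec.list_length.comp Primrec.snd)).and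
      (PrimrecPred.not (hQ.comp ((Primrec.fst.comp (Primrec.fst.comp Primrec.fst)).pair
        (Primrec.list_take.comp hn Primrec.snd))))
  · simp only [hA, not_exists]
    refine forall_congr' fun k => ⟨fun h => ⟨0, k + 1, ?_⟩, ?_⟩
    · simpa [length_restr, take_restr D k.le_succ] using h
    · rintro ⟨_, l, hl, h⟩
      rwa [take_restr D (by rw [length_restr] at hl; omega)] at h

namespace Pi2In

theorem of_eq {A B : α → Prop} (hA : Pi2In D A) (h : ∀ x, A x ↔ B x) : Pi2In D B :=
  (funext fun x => propext (h x) : A = B) ▸ hA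

theorem comp {A : β → Prop} (hA : Pi2In D A) {f : α → β} (hf : Primrec f) :
    Pi2In D fun x => A (f x) := by
  obtain ⟨B, hB, hA⟩ := hA
  exact ⟨fun p => B (f p.1, p.2), hB.comp ((hf.comp Primrec.fst).pair Primrec.snd),
    fun x => hA (f x)⟩

theorem forall_nat {A : α × ℕ → Prop} (hA : Pi2In D A) : Pi2In D fun x => ∀ n, A (x, n) := by
  obtain ⟨B, hB, hA⟩ := hA
  have hu : Primrec fun p : α × ℕ => p.2.unpair := Primrec.unpair.comp Primrec.snd
  refine ⟨fun p => B ((p.1, p.2.unpair.1), p.2.unpair.2), hB.comp ((Primrec.fst.pair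
    (Primrec.fst.comp hu)).pair (Primrec.snd.comp hu)), fun x => ?_⟩
  simp only [hA]
  exact ⟨fun h n => h _ _, fun h n m => by simpa using h (Nat.pair n m)⟩

protected theorem and {A B : α → Prop} (hA : Pi2In D A) (hB : Pi2In D B) :
    Pi2In D fun x => A x ∧ B x := by
  obtain ⟨A', hA', hA⟩ := hA
  obtain ⟨B', hB', hB⟩ := hB
  exact ⟨_, hA'.and hB', fun x => by simp only [hA, hB, forall_and]⟩

protected theorem or {A B : α → Prop} (hA : Pi2In D A) (hB : Pi2In D B) :
    Pi2In D fun x => A x ∨ B x := by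
  obtain ⟨A', hA', hA⟩ := hA
  obtain ⟨B', hB', hB⟩ := hB
  -- With separate variables, `(∀ n, A' n) ∨ (∀ m, B' m)` is equivalent to `∀ n m, A' n ∨ B' m`.
  have h : Pi2In D fun p : (α × ℕ) × ℕ => A' (p.1.1, p.1.2) ∨ B' (p.1.1, p.2) :=
    (REIn.or (hA'.comp Primrec.fst) (hB'.comp ((Primrec.fst.comp Primrec.fst).pair
      Primrec.snd))).pi2In
  refine h.forall_nat.forall_nat.of_eq fun x => ?_
  simp only [hA, hB, forall_or_left, forall_or_right]

end Pi2In

/-- The inner witness of the matrix can be taken to be the length of a prefix of `D`; the prefix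
itself is computed with the oracle. -/
theorem isPi2In_iff {R : ℕ → ℕ → Prop} :
    IsPi2In D R ↔ Pi2In D fun p : ℕ × ℕ => R p.1 p.2 := by
  constructor
  · rintro ⟨P, hP, hR⟩
    have hf : Primrec fun q : ((ℕ × ℕ) × ℕ) × ℕ => (q.1.1.1, q.1.1.2, q.1.2, q.2) :=
      (Primrec.fst.comp (Primrec.fst.comp Primrec.fst)).pair
        ((Primrec.snd.comp (Primrec.fst.comp Primrec.fst)).pair
          ((Primrec.snd.comp Primrec.fst).pair Primrec.snd))
    exact ⟨_, ((REIn.of_computableIn hP).comp hf).exists_nat, fun p => hR p.1 p.2⟩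
  · rintro ⟨B, ⟨Q, ⟨_, hQ⟩, -, hB⟩, hR⟩
    have hf : Primrec fun q : (ℕ × ℕ × ℕ × ℕ) × List ℕ =>
        (((q.1.1, q.1.2.1), q.1.2.2.1), q.2) :=
      (((Primrec.fst.comp Primrec.fst).pair (Primrec.fst.comp (Primrec.snd.comp Primrec.fst))).pair
        (Primrec.fst.comp (Primrec.snd.comp (Primrec.snd.comp Primrec.fst)))).pair Primrec.snd
    refine ⟨fun q => decide (Q (((q.1, q.2.1), q.2.2.1), restr D q.2.2.2)),
      computableIn_restr (hQ.comp hf) (Primrec.snd.comp (Primrec.snd.comp Primrec.snd)),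
      fun i j => ?_⟩
    simp only [hR (i, j), hB, decide_eq_true_eq]

/-! ### The halting set as an oracle -/

/-- The finite approximations of the characteristic function of the halting set. -/
def zeroJumpApprox (t k : ℕ) : List ℕ :=
  (List.range k).map fun i => cond (Code.evaln t (ofNat Code i) i).isSome 1 0

theorem primrec_zeroJumpApprox {t k : α → ℕ} (ht : Primrec t) (hk : Primrec k) :
    Primrec fun x => zeroJumpApprox (t x) (k x) :=
  Primrec.list_map (Primrec.list_range.comp hk) (Primrec.cond (Primrec.option_isSome.comp
    (primrec_evaln (ht.comp Primrec.fst) ((Primrec.ofNat Code).comp Primrec.snd) Primrec.snd))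
    (Primrec.const 1) (Primrec.const 0)).to₂

/-- Halting is approximated from below, so each entry changes at most once and finitely many entries
stabilise together. -/
theorem exists_zeroJumpApprox_eq (k : ℕ) :
    ∃ s, ∀ t ≥ s, zeroJumpApprox t k = restr zeroJump k := by
  have h : ∀ i, ∃ s, ∀ t ≥ s, cond (Code.evaln t (ofNat Code i) i).isSome 1 0 =
      zeroJump.indicator (1 : ℕ → ℕ) i := by
    intro i
    by_cases hi : i ∈ zeroJump
    · obtain ⟨y, hy⟩ := Part.dom_iff_mem.1 (show ((ofNat Code i).eval i).Dom from hi)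
      obtain ⟨s, hs⟩ := Code.evaln_complete.1 hy
      refine ⟨s, fun t ht => ?_⟩
      rw [Option.mem_def.1 (Code.evaln_mono ht hs)]
      simp [hi]
    · refine ⟨0, fun t _ => ?_⟩
      have : Code.evaln t (ofNat Code i) i = none := Option.eq_none_iff_forall_not_mem.2
        fun y hy => hi (Part.dom_iff_mem.2 ⟨y, Code.evaln_sound hy⟩)
      simp [this, hi]
  choose s hs using h
  refine ⟨(Finset.range k).sup s, fun t ht => List.map_congr_left fun i hi => hs i t ?_⟩
  exact le_trans (Finset.le_sup (f := s) (by simpa using hi)) ht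

/-- Forwards, the innermost universal quantifier says that a search for a counterexample diverges,
one question to the halting set. Backwards, a prefix of the halting set is the limit of its
approximations, so a condition on it is equivalent to its holding at all late stages. -/
theorem isPi3_iff {R : ℕ → ℕ → Prop} :
    IsPi3 R ↔ Pi2In zeroJump fun p : ℕ × ℕ => R p.1 p.2 := by
  constructor
  · rintro ⟨P, hP, hR⟩
    have hp : Partrec fun x : ℕ × ℕ × ℕ × ℕ => Nat.rfind fun c =>
        Part.some (!P (x.1, x.2.1, x.2.2.1, x.2.2.2, c)) := by
      have hf : Primrec fun q : (ℕ × ℕ × ℕ × ℕ) × ℕ =>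
          (q.1.1, q.1.2.1, q.1.2.2.1, q.1.2.2.2, q.2) :=
        (Primrec.fst.comp Primrec.fst).pair ((Primrec.fst.comp (Primrec.snd.comp
          Primrec.fst)).pair ((Primrec.fst.comp (Primrec.snd.comp (Primrec.snd.comp
          Primrec.fst))).pair ((Primrec.snd.comp (Primrec.snd.comp (Primrec.snd.comp
          Primrec.fst))).pair Primrec.snd)))
      have hn : Computable fun q : (ℕ × ℕ × ℕ × ℕ) × ℕ =>
          !P (q.1.1, q.1.2.1, q.1.2.2.1, q.1.2.2.2, q.2) :=
        Primrec.not.to_comp.comp (hP.comp hf.to_comp)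
      exact Partrec.rfind hn.partrec.to₂
    obtain ⟨c, hc⟩ := Code.exists_code.1 hp
    -- A program that ignores its input and runs the search on the given tuple; in particular its
    -- behaviour on its own code decides the search.
    let h : ((ℕ × ℕ) × ℕ) × ℕ → ℕ := fun q =>
      encode (Code.comp c (Code.const (encode (q.1.1.1, q.1.1.2, q.1.2, q.2))))
    have hh : Primrec h := by
      refine Primrec.encode.comp (Code.primrec₂_comp.comp (Primrec.const c)
        (Code.primrec_const.comp (Primrec.encode.comp ?_)))
      exact (Primrec.fst.comp (Primrec.fst.comp Primrec.fst)).pair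
        ((Primrec.snd.comp (Primrec.fst.comp Primrec.fst)).pair
          ((Primrec.snd.comp Primrec.fst).pair Primrec.snd))
    have hm : ∀ i j a b, h (((i, j), a), b) ∉ zeroJump ↔ ∀ c, P (i, j, a, b, c) = true := by
      intro i j a b
      have : h (((i, j), a), b) ∈ zeroJump ↔
          (Nat.rfind fun c => Part.some (!P (i, j, a, b, c))).Dom := by
        change ((ofNat Code (encode _)).eval _).Dom ↔ _
        rw [ofNat_encode, OCode.eval_comp, Code.eval_const, Part.bind_some, hc]
        simp
      rw [this, rfind_some_dom]
      simp
    refine ⟨_, (REIn.of_notMem.comp hh).exists_nat, fun p => ?_⟩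
    simp only [hm]
    exact hR p.1 p.2
  · rintro ⟨B, ⟨Q, ⟨_, hQ⟩, hmono, hB⟩, hR⟩
    -- The existential variable codes a prefix length and a stage `s`; the innermost universal
    -- variable runs through the stages from `s` on.
    refine ⟨fun q => decide (Q (((q.1, q.2.1), q.2.2.1), zeroJumpApprox
      (q.2.2.2.1.unpair.2 + q.2.2.2.2) q.2.2.2.1.unpair.1)), ?_, fun i j => ?_⟩
    · have h1 : Primrec fun q : ℕ × ℕ × ℕ × ℕ × ℕ => q.2.2 := Primrec.snd.comp Primrec.snd
      have h2 : Primrec fun q : ℕ × ℕ × ℕ × ℕ × ℕ => q.2.2.2.1.unpair :=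
        Primrec.unpair.comp (Primrec.fst.comp (Primrec.snd.comp h1))
      exact (hQ.comp (((Primrec.fst.pair (Primrec.fst.comp Primrec.snd)).pair
        (Primrec.fst.comp h1)).pair (primrec_zeroJumpApprox (Primrec.nat_add.comp
        (Primrec.snd.comp h2) (Primrec.snd.comp (Primrec.snd.comp h1)))
        (Primrec.fst.comp h2)))).to_comp
    · simp only [hR (i, j), hB, decide_eq_true_eq]
      refine forall_congr' fun a => ⟨fun ⟨k, hk⟩ => ?_, fun ⟨b, hb⟩ => ?_⟩
      · obtain ⟨s, hs⟩ := exists_zeroJumpApprox_eq k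
        refine ⟨Nat.pair k s, fun c => ?_⟩
        simp only [Nat.unpair_pair]
        rwa [hs _ (by omega)]
      · obtain ⟨s, hs⟩ := exists_zeroJumpApprox_eq b.unpair.1
        refine ⟨b.unpair.1, ?_⟩
        rw [← hs (b.unpair.2 + s) (by omega)]
        exact hb s

/-! ### The empty oracle -/

theorem isPi2_iff {R : ℕ → ℕ → Prop} : IsPi2 R ↔ IsPi2In ∅ R := by
  refine exists_congr fun P => and_congr_left' ⟨Computable.computableIn, fun h => ?_⟩
  refine RecursiveIn.partrec_of_const (s := Part.some 0) ?_
  have : charFun ∅ = fun _ => Part.some 0 := by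
    funext n
    simp [charFun]
  rwa [← this]

theorem restr_empty (k : ℕ) : restr ∅ k = (List.range k).map fun _ => 0 := by
  simp [restr]

theorem exists_WIn_eq_W : ∃ g : ℕ → ℕ, Primrec g ∧ ∀ e, WIn D (g e) = W e := by
  have hf : Primrec fun q : (ℕ × ℕ) × ℕ => ((ofNat Code q.1.1, q.1.2), q.2) :=
    (((Primrec.ofNat Code).comp (Primrec.fst.comp Primrec.fst)).pair
      (Primrec.snd.comp Primrec.fst)).pair Primrec.snd
  obtain ⟨g, hg, h⟩ := (REIn.of_mem_eval.comp hf).exists_nat.exists_index (D := D)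
  refine ⟨g, hg, fun e => Set.ext fun n => ?_⟩
  rw [h, W, Set.mem_ofPred_eq, Part.dom_iff_mem]

theorem exists_W_eq_WIn_empty : ∃ g : ℕ → ℕ, Primrec g ∧ ∀ e, W (g e) = WIn ∅ e := by
  obtain ⟨Q, ⟨_, hQ⟩, -, hA⟩ := REIn.of_mem_WIn (D := ∅)
  have hp : Partrec fun x : ℕ => Nat.rfind fun k =>
      Part.some (decide (Q (x.unpair, (List.range k).map fun _ => 0))) :=
    Partrec.rfind (Computable.partrec (hQ.comp ((Primrec.unpair.comp Primrec.fst).pair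
      (Primrec.list_map (Primrec.list_range.comp Primrec.snd)
        (Primrec.const 0).to₂))).to_comp).to₂
  obtain ⟨c, hc⟩ := Code.exists_code.1 (Partrec.nat_iff.1 hp)
  refine ⟨fun e => encode (Code.curry c e), Primrec.encode.comp (Code.primrec₂_curry.comp
    (Primrec.const c) Primrec.id), fun e => Set.ext fun n => ?_⟩
  refine Iff.trans ?_ (hA (e, n)).symm
  rw [W, Set.mem_ofPred_eq, ofNat_encode, Code.eval_curry, hc]
  refine rfind_some_dom.trans ?_
  simp [restr_empty]

theorem NaryReducible.of_iff {n : ℕ} {R E F : ℕ → ℕ → Prop} {g : ℕ → ℕ} (hg : Primrec g)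
    (h : ∀ i j, E i j ↔ F (g i) (g j)) (hR : NaryReducible n R E) : NaryReducible n R F := by
  obtain ⟨f, hf, hR⟩ := hR
  have hg' : Primrec fun (x : Fin n → ℕ) (i : Fin n) => g (x i) :=
    Primrec.fin_curry.2 (hg.comp Primrec.fin_app)
  exact ⟨fun x i => g (f x i), hg'.to_comp.comp hf, fun x i j hij => (hR x i j hij).trans (h _ _)⟩

variable {L : ℕ → ℕ → Prop}

/-! ### Completeness for ternary reducibility and failure for `4`-ary reducibility -/

/-- `L e n` expresses that the set with index `e` has size at least `n`, for some notion of size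
that takes the value `n` on the initial segment of length `n`. -/
structure IsSize (D : Set ℕ) (L : ℕ → ℕ → Prop) : Prop where
  re : REIn D fun p : ℕ × ℕ => L p.1 p.2
  zero : ∀ e, L e 0
  anti : ∀ e m n, m ≤ n → L e n → L e m
  segment : ∀ e, (∀ n ∈ WIn D e, ∀ m < n, m ∈ WIn D e) → ∀ n, L e n ↔ ∀ i < n, i ∈ WIn D e

/-- Equality of sizes. -/
def SameSize (L : ℕ → ℕ → Prop) (i j : ℕ) : Prop := ∀ n, L i n ↔ L j n

theorem SameSize.equivalence : Equivalence (SameSize L) where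
  refl _ _ := Iff.rfl
  symm h n := (h n).symm
  trans h h' n := (h n).trans (h' n)

namespace IsSize

theorem isPi2In_sameSize (hL : IsSize D L) : IsPi2In D (SameSize L) := by
  have h1 : Primrec fun q : (ℕ × ℕ) × ℕ => (q.1.1, q.2) :=
    (Primrec.fst.comp Primrec.fst).pair Primrec.snd
  have h2 : Primrec fun q : (ℕ × ℕ) × ℕ => (q.1.2, q.2) :=
    (Primrec.snd.comp Primrec.fst).pair Primrec.snd
  have a := hL.re.comp h1
  have b := hL.re.comp h2
  refine isPi2In_iff.2 ((((a.pi2In_not.or b.pi2In).and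
    (b.pi2In_not.or a.pi2In)).forall_nat).of_eq fun p => forall_congr' fun n => ?_)
  simp only
  tauto

/-- Equality of sizes is complete for ternary reducibility. -/
theorem naryReducible_three (hL : IsSize D L) {R : ℕ → ℕ → Prop} (hR : Equivalence R)
    (h2 : IsPi2In D R) : NaryReducible 3 R (SameSize L) := by
  obtain ⟨B, hB, hRB⟩ := isPi2In_iff.1 h2
  replace hRB : ∀ u v, R u v ↔ ∀ n, B ((u, v), n) := fun u v => hRB (u, v)
  -- For `p = ((u, v, w), r)`, `G p n` says that the first `n` instances of `R u v` or of `R u w`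
  -- are confirmed. It holds at `n = 0` and is closed downwards. The set built from `p` is the union
  -- of the segments below `3 * k + r` with `G p k`.
  let G : ((ℕ × ℕ × ℕ) × ℕ) → ℕ → Prop := fun p n =>
    (∀ a < n, B ((p.1.1, p.1.2.1), a)) ∨ ∀ a < n, B ((p.1.1, p.1.2.2), a)
  have hG : REIn D fun q : (((ℕ × ℕ × ℕ) × ℕ) × ℕ) × ℕ => q.1.2 < 3 * q.2 + q.1.1.2 ∧ G q.1.1 q.2 := by
    have ht : Primrec fun q : (((ℕ × ℕ × ℕ) × ℕ) × ℕ) × ℕ => q.1.1.1 :=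
      Primrec.fst.comp (Primrec.fst.comp Primrec.fst)
    refine REIn.and (REIn.of_primrecPred (Primrec.nat_lt.comp (Primrec.snd.comp Primrec.fst)
      (Primrec.nat_add.comp (Primrec.nat_mul.comp (Primrec.const 3) Primrec.snd)
      (Primrec.snd.comp (Primrec.fst.comp Primrec.fst))))) (REIn.or ?_ ?_)
    · exact hB.forall_lt.comp (f := fun q : (((ℕ × ℕ × ℕ) × ℕ) × ℕ) × ℕ =>
        ((q.1.1.1.1, q.1.1.1.2.1), q.2)) (((Primrec.fst.comp ht).pair (Primrec.fst.comp
        (Primrec.snd.comp ht))).pair Primrec.snd)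
    · exact hB.forall_lt.comp (f := fun q : (((ℕ × ℕ × ℕ) × ℕ) × ℕ) × ℕ =>
        ((q.1.1.1.1, q.1.1.1.2.2), q.2)) (((Primrec.fst.comp ht).pair (Primrec.snd.comp
        (Primrec.snd.comp ht))).pair Primrec.snd)
  obtain ⟨g, hg, hgW⟩ := hG.exists_nat.exists_index
  have hgL : ∀ p n, L (g p) n ↔ ∀ i < n, ∃ k, i < 3 * k + p.2 ∧ G p k := by
    intro p n
    simp only [hL.segment (g p) (fun n hn m hm => by
      rw [hgW] at hn ⊢
      obtain ⟨k, hk⟩ := hn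
      exact ⟨k, lt_trans hm hk.1, hk.2⟩) n, hgW]
  have hinf : ∀ p, (R p.1.1 p.1.2.1 ∨ R p.1.1 p.1.2.2) → ∀ n, L (g p) n := by
    intro p hp n
    rw [hgL]
    exact fun i _ => ⟨i + 1, by omega, hp.imp (fun h a _ => (hRB _ _).1 h a)
      fun h a _ => (hRB _ _).1 h a⟩
  have hfin : ∀ p, ¬ (R p.1.1 p.1.2.1 ∨ R p.1.1 p.1.2.2) →
      ∃ N, ∀ n, L (g p) n ↔ n ≤ 3 * N + p.2 := by
    intro p hp
    have hex : ∃ n, ¬ G p n := by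
      by_contra! h
      rw [not_or, hRB, hRB] at hp
      push Not at hp
      obtain ⟨⟨a, ha⟩, b, hb⟩ := hp
      rcases h (max a b + 1) with h | h
      · exact ha (h a (by omega))
      · exact hb (h b (by omega))
    classical
    have hpos : Nat.find hex ≠ 0 := by
      rw [Ne, Nat.find_eq_zero, not_not]
      exact Or.inl fun a ha => absurd ha (Nat.not_lt_zero a)
    -- `N` is the last stage before the first failure; it exists because `G p 0` holds.
    obtain ⟨N, hN⟩ : ∃ N, ∀ k, G p k ↔ k ≤ N := by
      refine ⟨Nat.find hex - 1, fun k => ⟨fun hk => ?_, fun hk => ?_⟩⟩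
      · by_contra hlt
        refine Nat.find_spec hex (hk.imp (fun h a ha => h a ?_) fun h a ha => h a ?_) <;> omega
      · exact not_not.1 (Nat.find_min hex (by omega))
    refine ⟨N, fun n => ?_⟩
    simp only [hgL, hN]
    constructor
    · intro h
      by_contra hn
      obtain ⟨k, hk⟩ := h (3 * N + p.2) (by omega)
      omega
    · exact fun h i hi => ⟨N, by omega, le_rfl⟩
  -- Addition in `Fin 3` is cyclic, so `i + 1` and `i + 2` are the other two coordinates; `(i : ℕ)`
  -- is the residue reserved for coordinate `i`.
  have hf : Primrec fun (x : Fin 3 → ℕ) (i : Fin 3) => g ((x i, x (i + 1), x (i + 2)), (i : ℕ)) := by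
    have hx : ∀ s : Fin 3 → Fin 3, Primrec fun q : (Fin 3 → ℕ) × Fin 3 => q.1 (s q.2) :=
      fun s => Primrec.fin_app.comp Primrec.fst ((Primrec.dom_finite s).comp Primrec.snd)
    exact Primrec.fin_curry.2 (hg.comp (((hx id).pair ((hx (· + 1)).pair (hx (· + 2)))).pair
      (Primrec.fin_val.comp Primrec.snd)))
  refine ⟨_, hf.to_comp, fun x i j hij => ?_⟩
  have hne : (i : ℕ) ≠ j := by simpa [Fin.ext_iff] using hij.ne
  -- The third conjunct is where three points matter: if two of them each have a related partner,
  -- transitivity makes them related to each other.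
  have key : (R (x i) (x j) → R (x i) (x (i + 1)) ∨ R (x i) (x (i + 2))) ∧
      (R (x i) (x j) → R (x j) (x (j + 1)) ∨ R (x j) (x (j + 2))) ∧
      (R (x i) (x (i + 1)) ∨ R (x i) (x (i + 2)) → R (x j) (x (j + 1)) ∨ R (x j) (x (j + 2)) →
        R (x i) (x j)) := by
    have h : ∀ i j : Fin 3, i < j → j = i + 1 ∧ j + 1 = i + 2 ∧ j + 2 = i ∨
        j = i + 2 ∧ j + 1 = i ∧ j + 2 = i + 1 := by decide
    have hs := fun {u v} => @Equivalence.symm _ _ hR u v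
    have ht := fun {u v w} => @Equivalence.trans _ _ hR u v w
    rcases h i j hij with ⟨h0, h1, h2⟩ | ⟨h0, h1, h2⟩
    · rw [h1, h2, ← h0]
      exact ⟨Or.inl, fun h => Or.inr (hs h), fun h h' => h.elim id fun h => h'.elim
        (fun h' => ht h (hs h')) hs⟩
    · rw [h1, h2, ← h0]
      exact ⟨Or.inr, fun h => Or.inl (hs h), fun h h' => h.elim (fun h => h'.elim hs
        fun h' => ht h (hs h')) id⟩
  obtain ⟨hi, hj, hij⟩ := key
  constructor
  · exact fun h n => iff_of_true (hinf _ (hi h) n) (hinf _ (hj h) n)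
  · intro h
    by_cases ci : R (x i) (x (i + 1)) ∨ R (x i) (x (i + 2)) <;>
      by_cases cj : R (x j) (x (j + 1)) ∨ R (x j) (x (j + 2))
    · exact hij ci cj
    · obtain ⟨N, hN⟩ := hfin ((x j, x (j + 1), x (j + 2)), (j : ℕ)) cj
      have := (hN (3 * N + j + 1)).1 ((h _).1 (hinf _ ci _))
      simp only at this
      omega
    · obtain ⟨N, hN⟩ := hfin ((x i, x (i + 1), x (i + 2)), (i : ℕ)) ci
      have := (hN (3 * N + i + 1)).1 ((h _).2 (hinf _ cj _))
      simp only at this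
      omega
    -- Both sizes are finite, `3 * N + i` and `3 * M + j`, and differ modulo 3.
    · obtain ⟨N, hN⟩ := hfin ((x i, x (i + 1), x (i + 2)), (i : ℕ)) ci
      obtain ⟨M, hM⟩ := hfin ((x j, x (j + 1), x (j + 2)), (j : ℕ)) cj
      have h1 := (hN _).1 ((h _).2 ((hM _).2 le_rfl))
      have h2 := (hM _).1 ((h _).1 ((hN _).2 le_rfl))
      simp only at h1 h2
      omega

/-- The heart of the diagonalisation. Different sizes would, by the hypothesis, share an exact
finite value and hence agree; so the sizes are equal, and by the hypothesis again their common value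
is not finite. -/
theorem forall_of_iff_not_exists (hL : IsSize D L) {a b : ℕ}
    (h : SameSize L a b ↔ ¬ ∃ c, L a c ∧ L b c ∧ ¬ L a (c + 1) ∧ ¬ L b (c + 1)) (n : ℕ) :
    L a n := by
  have hab : SameSize L a b := by
    by_contra hab
    obtain ⟨c, ha, hb, ha', hb'⟩ := not_not.1 (mt h.2 hab)
    refine hab fun n => ?_
    rcases le_or_gt n c with hn | hn
    · exact iff_of_true (hL.anti _ _ _ hn ha) (hL.anti _ _ _ hn hb)
    · exact iff_of_false (fun h => ha' (hL.anti _ _ _ hn h)) fun h => hb' (hL.anti _ _ _ hn h)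
  induction n with
  | zero => exact hL.zero a
  | succ n ih =>
    by_contra hn
    exact h.1 hab ⟨n, ih, (hab n).1 ih, hn, fun h => hn ((hab _).2 h)⟩

/-- Equality of sizes is not complete for `4`-ary reducibility. -/
theorem exists_not_naryReducible_four (hL : IsSize D L) :
    ∃ R : ℕ → ℕ → Prop, Equivalence R ∧ IsPi2In D R ∧ ¬ NaryReducible 4 R (SameSize L) := by
  -- `t e` is the quadruple on which the `e`-th program is defeated. `B (4 * e + i, n)` says that
  -- this program halts on `t e` and that coordinate `i` of its output has size at least `n`.
  let t : ℕ → Fin 4 → ℕ := fun e i => 4 * e + i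
  let d : ℕ → Fin 4 → ℕ := fun y i => ((@decode (Fin 4 → ℕ) Primcodable.toEncodable y).map fun v => v i).getD 0
  let B : ℕ × ℕ → Prop := fun q =>
    ∃ y, y ∈ (ofNat Code (q.1 / 4)).eval (@encode _ Primcodable.toEncodable (t (q.1 / 4))) ∧ L (d y (Fin.ofNat 4 q.1)) q.2
  have hB : REIn D B := by
    have hp : Primrec fun q : (ℕ × ℕ) × ℕ => q.1.1 := Primrec.fst.comp Primrec.fst
    have he : Primrec fun q : (ℕ × ℕ) × ℕ => q.1.1 / 4 := Primrec.nat_div.comp hp (Primrec.const 4)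
    have hi : Primrec fun q : (ℕ × ℕ) × ℕ => Fin.ofNat 4 q.1.1 :=
      Primrec.fin_val_iff.1 (Primrec.nat_mod.comp hp (Primrec.const 4))
    have ht : Primrec t := Primrec.fin_curry.2 (Primrec.nat_add.comp (Primrec.nat_mul.comp
      (Primrec.const 4) Primrec.fst) (Primrec.fin_val.comp Primrec.snd))
    have hd : Primrec fun q : ℕ × Fin 4 => d q.1 q.2 :=
      Primrec.option_getD.comp (Primrec.option_map (Primrec.decode.comp Primrec.fst)
        (Primrec.fin_app.comp Primrec.snd (Primrec.snd.comp Primrec.fst)).to₂) (Primrec.const 0)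
    refine REIn.exists_nat (A := fun q : (ℕ × ℕ) × ℕ => q.2 ∈ (ofNat Code (q.1.1 / 4)).eval
      (@encode _ Primcodable.toEncodable (t (q.1.1 / 4))) ∧ L (d q.2 (Fin.ofNat 4 q.1.1)) q.1.2) (REIn.and ?_ ?_)
    · exact REIn.of_mem_eval.comp ((((Primrec.ofNat Code).comp he).pair
        (Primrec.encode.comp (ht.comp he))).pair Primrec.snd)
    · exact hL.re.comp ((hd.comp (Primrec.snd.pair hi)).pair (Primrec.snd.comp Primrec.fst))
  -- `S` denies a common exact finite size. If the program of a point diverges, `B` never holds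
  -- there, so `S` is true for it.
  let S : ℕ → ℕ → Prop := fun p q =>
    ¬ ∃ c, B (p, c) ∧ B (q, c) ∧ ¬ B (p, c + 1) ∧ ¬ B (q, c + 1)
  refine ⟨fun p q => p = q ∨ p / 2 = q / 2 ∧ S p q, ⟨fun _ => Or.inl rfl, ?_, ?_⟩, ?_, ?_⟩
  · rintro p q (rfl | ⟨h, hS⟩)
    · exact Or.inl rfl
    · exact Or.inr ⟨h.symm, fun ⟨c, h⟩ => hS ⟨c, h.2.1, h.1, h.2.2.2, h.2.2.1⟩⟩
  · rintro p q r (rfl | ⟨h, hS⟩) (rfl | ⟨h', hS'⟩)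
    · exact Or.inl rfl
    · exact Or.inr ⟨h', hS'⟩
    · exact Or.inr ⟨h, hS⟩
    -- A class of `p / 2` has only two elements, so transitivity of `S` is never needed.
    · obtain rfl | rfl | rfl : p = q ∨ q = r ∨ p = r := by omega
      · exact Or.inr ⟨h', hS'⟩
      · exact Or.inr ⟨h, hS⟩
      · exact Or.inl rfl
  · have hsnd : Primrec fun q : (ℕ × ℕ) × ℕ => q.2 + 1 := Primrec.succ.comp Primrec.snd
    have h1 : Primrec fun q : (ℕ × ℕ) × ℕ => q.1.1 := Primrec.fst.comp Primrec.fst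
    have h2 : Primrec fun q : (ℕ × ℕ) × ℕ => q.1.2 := Primrec.snd.comp Primrec.fst
    have hS : Pi2In D fun p : ℕ × ℕ => ∀ c, (¬ B (p.1, c) ∨ ¬ B (p.2, c)) ∨
        (B (p.1, c + 1) ∨ B (p.2, c + 1)) :=
      Pi2In.forall_nat (A := fun q : (ℕ × ℕ) × ℕ => (¬ B (q.1.1, q.2) ∨ ¬ B (q.1.2, q.2)) ∨
        (B (q.1.1, q.2 + 1) ∨ B (q.1.2, q.2 + 1)))
        (((hB.comp (h1.pair Primrec.snd)).pi2In_not.or (hB.comp (h2.pair Primrec.snd)).pi2In_not).or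
          ((hB.comp (h1.pair hsnd)).or (hB.comp (h2.pair hsnd))).pi2In)
    have hdiv : PrimrecPred fun p : ℕ × ℕ => p.1 / 2 = p.2 / 2 :=
      Primrec.eq.comp (Primrec.nat_div.comp Primrec.fst (Primrec.const 2))
        (Primrec.nat_div.comp Primrec.snd (Primrec.const 2))
    refine isPi2In_iff.2 (((REIn.of_primrecPred Primrec.eq).pi2In.or
      ((REIn.of_primrecPred hdiv).pi2In.and hS)).of_eq fun p => ?_)
    refine or_congr Iff.rfl (and_congr_right' ?_)
    simp only [S, not_exists]
    exact forall_congr' fun c => by simp only [not_and_or, not_not, or_assoc]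
  · rintro ⟨f, hf, hfR⟩
    obtain ⟨c, hc⟩ := Code.exists_code.1 hf
    obtain ⟨e, he⟩ : ∃ e, ofNat Code e = c := ⟨encode c, ofNat_encode c⟩
    have hBL : ∀ (i : Fin 4) n, B (4 * e + i, n) ↔ L (f (t e) i) n := by
      intro i n
      have h1 : (4 * e + (i : ℕ)) / 4 = e := by omega
      have h2 : Fin.ofNat 4 (4 * e + (i : ℕ)) = i := by
        ext
        simp [Fin.ofNat]
      simp only [B, h1, h2, he, hc]
      simp [d]
    have hpair : ∀ i j : Fin 4, i < j → (4 * e + i : ℕ) / 2 = (4 * e + j) / 2 →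
        ∀ n, L (f (t e) i) n := by
      intro i j hij hdiv
      have hne : (4 * e + i : ℕ) ≠ 4 * e + j := by
        have := Fin.lt_def.1 hij
        omega
      refine hL.forall_of_iff_not_exists (b := f (t e) j) ((hfR (t e) i j hij).symm.trans ?_)
      simp only [t, hne, false_or, hdiv, true_and, S, hBL]
    have h0 := hpair 0 1 (by decide) (by simp; omega)
    have h2 := hpair 2 3 (by decide) (by simp; omega)
    -- Coordinates 0 and 2 lie in different pairs, yet both have infinite size.
    have := (hfR (t e) 0 2 (by decide)).2 fun n => iff_of_true (h0 n) (h2 n)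
    simp [t] at this

theorem isNaryComplete_three (hL : IsSize D L) : IsNaryComplete 3 (IsPi2In D) (SameSize L) :=
  ⟨SameSize.equivalence, hL.isPi2In_sameSize, fun _ => hL.naryReducible_three⟩

theorem not_isNaryComplete_four (hL : IsSize D L) :
    ¬ IsNaryComplete 4 (IsPi2In D) (SameSize L) := fun h => by
  obtain ⟨R, hR, h2, hn⟩ := hL.exists_not_naryReducible_four
  exact hn (h.2.2 R hR h2)

end IsSize

/-! ### Maxima and cardinalities -/

theorem le_setMax_iff {A : Set ℕ} {n : ℕ} :
    ((n : ℕ∞) : WithBot ℕ∞) ≤ setMax A ↔ ∃ m ∈ A, n ≤ m := by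
  constructor
  · intro h
    by_contra! hA
    cases n with
    -- Even the bound `0` requires an element, since the maximum of the empty set is `⊥`.
    | zero =>
      have : setMax A ≤ ⊥ := iSup₂_le fun m hm => absurd (hA m hm) (Nat.not_lt_zero m)
      simpa using h.trans this
    | succ n =>
      have : setMax A ≤ ((n : ℕ∞) : WithBot ℕ∞) := iSup₂_le fun m hm => by
        exact_mod_cast Nat.le_of_lt_succ (hA m hm)
      have := h.trans this
      norm_cast at this
      omega
  · rintro ⟨m, hm, hn⟩
    exact le_trans (by exact_mod_cast hn)
      (le_iSup₂ (f := fun (n : ℕ) (_ : n ∈ A) => ((n : ℕ∞) : WithBot ℕ∞)) m hm)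

theorem setMax_eq_iff {A B : Set ℕ} :
    setMax A = setMax B ↔ ∀ n, (∃ m ∈ A, n ≤ m) ↔ ∃ m ∈ B, n ≤ m := by
  constructor
  · intro h n
    rw [← le_setMax_iff, ← le_setMax_iff, h]
  · intro h
    exact le_antisymm (iSup₂_le fun m hm => le_setMax_iff.2 ((h m).1 ⟨m, hm, le_rfl⟩))
      (iSup₂_le fun m hm => le_setMax_iff.2 ((h m).2 ⟨m, hm, le_rfl⟩))

/-- The maximum is shifted by one so that the empty set has size 0 and `{0}` has size 1; an initial
segment then has its length as size. -/
theorem isSize_max (D : Set ℕ) : IsSize D fun e n => n = 0 ∨ ∃ m, m ∈ WIn D e ∧ n ≤ m + 1 where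
  re := by
    refine REIn.or (REIn.of_primrecPred (Primrec.eq.comp Primrec.snd (Primrec.const 0)))
      (REIn.exists_nat (A := fun q : (ℕ × ℕ) × ℕ => q.2 ∈ WIn D q.1.1 ∧ q.1.2 ≤ q.2 + 1)
      (REIn.and (REIn.of_mem_WIn.comp ((Primrec.fst.comp Primrec.fst).pair Primrec.snd))
      (REIn.of_primrecPred (Primrec.nat_le.comp (Primrec.snd.comp Primrec.fst)
        (Primrec.succ.comp Primrec.snd)))))
  zero _ := Or.inl rfl
  anti e m n hmn := by
    rintro (rfl | ⟨k, hk, hn⟩)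
    · exact Or.inl (by omega)
    · exact Or.inr ⟨k, hk, by omega⟩
  segment e he n := by
    constructor
    · rintro (rfl | ⟨m, hm, hn⟩) i hi
      · omega
      · rcases (show i ≤ m by omega).eq_or_lt with rfl | h
        · exact hm
        · exact he m hm i h
    · intro h
      cases n with
      | zero => exact Or.inl rfl
      | succ n => exact Or.inr ⟨n, h n (by omega), le_rfl⟩

theorem emaxIn_eq (D : Set ℕ) :
    EmaxIn D = SameSize fun e n => n = 0 ∨ ∃ m, m ∈ WIn D e ∧ n ≤ m + 1 := by
  funext i j
  rw [EmaxIn, setMax_eq_iff, SameSize, eq_iff_iff]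
  constructor
  · intro h n
    cases n with
    | zero => simp
    | succ n => simpa using h n
  · exact fun h n => by simpa using h (n + 1)

/-- Cardinality at least `n` is c.e. in `D` because some finite prefix of `D` confirms `n` members
at once. -/
theorem isSize_card (D : Set ℕ) : IsSize D fun e n => (n : ℕ∞) ≤ (WIn D e).encard where
  re := by
    obtain ⟨Q, ⟨_, hQ⟩, hm, hA⟩ := REIn.of_mem_WIn (D := D)
    replace hA : ∀ e n, n ∈ WIn D e ↔ ∃ k, Q ((e, n), restr D k) := fun e n => hA (e, n)
    have hR : PrimrecRel fun (m : ℕ) (p : ℕ × List ℕ) => Q ((p.1, m), p.2) :=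
      PrimrecPred.comp ⟨_, hQ⟩ (((Primrec.fst.comp Primrec.snd).pair Primrec.fst).pair
        (Primrec.snd.comp Primrec.snd))
    refine REIn.mk (Q := fun q => q.1.1.2 ≤ ((List.range q.2.length).filter fun m =>
      Q ((q.1.1.1, m), q.2)).length) ?_ fun p => ?_
    · exact Primrec.nat_le.comp (Primrec.snd.comp (Primrec.fst.comp Primrec.fst))
        (Primrec.list_length.comp (hR.listFilter.comp (Primrec.list_range.comp
        (Primrec.list_length.comp Primrec.snd)) ((Primrec.fst.comp (Primrec.fst.comp
        Primrec.fst)).pair Primrec.snd)))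
    · simp only [length_restr]
      constructor
      · intro h
        obtain ⟨t, ht, hc⟩ := Set.exists_subset_encard_eq h
        have hfin : t.Finite := Set.finite_of_encard_eq_coe hc
        obtain ⟨t, rfl⟩ := hfin.exists_finset_coe
        rw [Set.encard_coe_eq_coe_finsetCard, Nat.cast_inj] at hc
        have : ∀ m, ∃ k, m ∈ t → Q ((p.1, m), restr D k) := fun m => by
          by_cases hm : m ∈ t
          · exact ((hA _ _).1 (ht hm)).imp fun _ h _ => h
          · exact ⟨0, fun h => absurd h hm⟩
        choose k hk using this
        -- The prefix must be longer than each `m ∈ t`, so that `m` is inspected, and at least as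
        -- long as the prefix `k m` that confirms `m`.
        refine ⟨0, t.sup fun m => max (m + 1) (k m), ?_⟩
        rw [← hc]
        refine le_trans (Finset.card_le_card fun m hmt => ?_) (List.toFinset_card_le _)
        have hle : max (m + 1) (k m) ≤ t.sup fun m => max (m + 1) (k m) :=
          Finset.le_sup (f := fun m => max (m + 1) (k m)) hmt
        simp only [List.mem_toFinset, List.mem_filter, List.mem_range, decide_eq_true_eq]
        exact ⟨by omega, hm _ _ _ (le_trans (le_max_right _ _) hle) (hk m hmt)⟩
      · rintro ⟨_, k, hk⟩
        have hnd : ((List.range k).filter fun m => Q ((p.1, m), restr D k)).Nodup :=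
          List.nodup_range.filter _
        rw [← List.toFinset_card_of_nodup hnd] at hk
        refine le_trans (Nat.cast_le.2 hk) ?_
        rw [← Set.encard_coe_eq_coe_finsetCard]
        refine Set.encard_le_encard fun m hm => (hA _ _).2 ⟨k, ?_⟩
        simp only [List.coe_toFinset, List.mem_filter, decide_eq_true_eq] at hm
        exact hm.2
  zero _ := by simp
  anti _ _ _ h := le_trans (Nat.cast_le.2 h)
  segment e he n := by
    have hcard : ∀ n : ℕ, (Set.Iio n).encard = n := fun n => by
      rw [← Finset.coe_Iio, Set.encard_coe_eq_coe_finsetCard, Nat.card_Iio]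
    constructor
    · intro h i hi
      by_contra hn
      have : WIn D e ⊆ Set.Iio i := fun m hm => by
        by_contra hmi
        rcases (not_lt.1 (show ¬ m < i from hmi)).eq_or_lt with rfl | h
        · exact hn hm
        · exact hn (he m hm i h)
      have := h.trans (Set.encard_le_encard this)
      rw [hcard, Nat.cast_le] at this
      omega
    · intro h
      rw [← hcard n]
      exact Set.encard_le_encard fun i hi => h i hi

theorem ecardIn_eq (D : Set ℕ) :
    EcardIn D = SameSize fun e n => (n : ℕ∞) ≤ (WIn D e).encard := by
  funext i j
  rw [EcardIn, SameSize, eq_iff_iff]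
  exact ⟨fun h n => by rw [h], fun h => le_antisymm
    (ENat.forall_natCast_le_iff_le.1 fun n => (h n).1)
    (ENat.forall_natCast_le_iff_le.1 fun n => (h n).2)⟩

/-- The two enumerations translate into each other primitive recursively, and the translations
compose with reductions in both directions. -/
theorem isNaryComplete_emaxCE_iff {n : ℕ} :
    IsNaryComplete n IsPi2 EmaxCE ↔ IsNaryComplete n (IsPi2In ∅) (EmaxIn ∅) := by
  obtain ⟨g, hg, hgW⟩ := exists_WIn_eq_W (D := ∅)
  obtain ⟨k, hk, hkW⟩ := exists_W_eq_WIn_empty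
  have hG : IsPi2 = IsPi2In ∅ := funext fun _ => propext isPi2_iff
  have h1 : ∀ i j, EmaxCE i j ↔ EmaxIn ∅ (g i) (g j) := fun i j => by
    simp only [EmaxCE, EmaxIn, hgW]
  have h2 : ∀ i j, EmaxIn ∅ i j ↔ EmaxCE (k i) (k j) := fun i j => by
    simp only [EmaxCE, EmaxIn, hkW]
  have hpi : IsPi2In ∅ EmaxCE := by
    rw [isPi2In_iff]
    have h := (isSize_max ∅).isPi2In_sameSize
    rw [← emaxIn_eq, isPi2In_iff] at h
    exact (h.comp ((hg.comp Primrec.fst).pair (hg.comp Primrec.snd))).of_eq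
      fun p => (h1 p.1 p.2).symm
  rw [hG]
  constructor
  · rintro ⟨-, -, h⟩
    refine ⟨⟨fun _ => rfl, Eq.symm, Eq.trans⟩, ?_, fun R hR hp => (h R hR hp).of_iff hg h1⟩
    rw [emaxIn_eq]
    exact (isSize_max ∅).isPi2In_sameSize
  · rintro ⟨-, -, h⟩
    exact ⟨⟨fun _ => rfl, Eq.symm, Eq.trans⟩, hpi, fun R hR hp => (h R hR hp).of_iff hk h2⟩

end FinRed

theorem mainTheorem4 :
    (FinRed.IsNaryComplete 3 FinRed.IsPi2 FinRed.EmaxCE ∧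
      ¬ FinRed.IsNaryComplete 4 FinRed.IsPi2 FinRed.EmaxCE) ∧
    (∀ D : Set ℕ,
      FinRed.IsNaryComplete 3 (FinRed.IsPi2In D) (FinRed.EmaxIn D) ∧
      ¬ FinRed.IsNaryComplete 4 (FinRed.IsPi2In D) (FinRed.EmaxIn D)) ∧
    (FinRed.IsNaryComplete 3 FinRed.IsPi3 (FinRed.EcardIn FinRed.zeroJump) ∧
      ¬ FinRed.IsNaryComplete 4 FinRed.IsPi3 (FinRed.EcardIn FinRed.zeroJump)) := by
  have hmax : ∀ D : Set ℕ,
      FinRed.IsNaryComplete 3 (FinRed.IsPi2In D) (FinRed.EmaxIn D) ∧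
      ¬ FinRed.IsNaryComplete 4 (FinRed.IsPi2In D) (FinRed.EmaxIn D) := fun D => by
    rw [FinRed.emaxIn_eq]
    exact ⟨(FinRed.isSize_max D).isNaryComplete_three,
      (FinRed.isSize_max D).not_isNaryComplete_four⟩
  have hpi : FinRed.IsPi3 = FinRed.IsPi2In FinRed.zeroJump :=
    funext fun _ => propext (FinRed.isPi3_iff.trans FinRed.isPi2In_iff.symm)
  refine ⟨?_, hmax, ?_⟩
  · rw [FinRed.isNaryComplete_emaxCE_iff, FinRed.isNaryComplete_emaxCE_iff]
    exact hmax ∅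
  · rw [hpi, FinRed.ecardIn_eq]
    exact ⟨(FinRed.isSize_card _).isNaryComplete_three,
      (FinRed.isSize_card _).not_isNaryComplete_four⟩
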